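/- Let $\mathfrak{sl}_2$ be the complex Lie algebra with basis $e,h,f$ and brackets $[e,f]=h$, $[h,e]=2e$, $[h,f]=-2f$. Let $D=\mathbb{C}[x]/(x^2)$ and let $\mathfrak{g}=\mathfrak{sl}_2\otimes_{\mathbb{C}}D$ be the Takiff Lie algebra of $\mathfrak{sl}_2$, with bracket $[a\otimes s,b\otimes t]=[a,b]\otimes st$. Let $\overline{\mathfrak{b}}\subset\mathfrak{g}$ be the Lie subalgebra spanned by $h\otimes 1$, $h\otimes x$, $e\otimes 1$, $e\otimes x$. Let $\mathfrak{g}\text{-Mod}$ be the category of all $\mathfrak{g}$-modules (equivalently, left $U(\mathfrak{g})$-modules), and let the thick category $\widetilde{\mathcal{O}}$ be its full subcategory of those finitely generated $\mathfrak{g}$-modules $M$ on which $U(\overline{\mathfrak{b}})$ acts locally finitely, that is, $\dim_{\mathbb{C}}U(\overline{\mathfrak{b}})m<\infty$ for every $m\in M$. It is an abelian category and its inclusion into $\mathfrak{g}\text{-Mod}$ is exact. Theorem. $\widetilde{\mathcal{O}}$ is extension full in $\mathfrak{g}\text{-Mod}$: for all $M,N\in\widetilde{\mathcal{O}}$ and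 all $i\ge 0$, the homomorphism of abelian groups $$\mathrm{Ext}^i_{\widetilde{\mathcal{O}}}(M,N)\to\mathrm{Ext}^i_{\mathfrak{g}\text{-Mod}}(M,N)$$ induced by the inclusion is an isomorphism. -/

import Mathlib

universe v

namespace Takiff

section Noetherian

variable {R L : Type*} [CommRing R] [LieRing L] [LieAlgebra R L]

open UniversalEnvelopingAlgebra MvPolynomial

/-- The product in `U(L)` of the word `l` in the elements `x i` of `L`. -/
noncomputable def word {n : ℕ} (x : Fin n → L) (l : List (Fin n)) :
    UniversalEnvelopingAlgebra R L :=
  (l.map fun i => UniversalEnvelopingAlgebra.ι R (x i)).prod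

/-- The span in `U(L)` of the words of length less than `d`. -/
noncomputable def filt (R : Type*) {L : Type*} [CommRing R] [LieRing L] [LieAlgebra R L]
    {n : ℕ} (x : Fin n → L) (d : ℕ) : Submodule R (UniversalEnvelopingAlgebra R L) :=
  Submodule.span R (word x '' {l | l.length < d})

lemma word_cons {n : ℕ} (x : Fin n → L) (i : Fin n) (l : List (Fin n)) :
    word (R := R) x (i :: l) = UniversalEnvelopingAlgebra.ι R (x i) * word x l := by
  simp [word]

lemma word_mem {n : ℕ} (x : Fin n → L) {l : List (Fin n)} {d : ℕ} (h : l.length < d) :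
    word x l ∈ filt R x d :=
  Submodule.subset_span ⟨l, h, rfl⟩

lemma mul_mem_filt {n : ℕ} (x : Fin n → L) (i : Fin n) {d : ℕ}
    {u : UniversalEnvelopingAlgebra R L} (hu : u ∈ filt R x d) :
    UniversalEnvelopingAlgebra.ι R (x i) * u ∈ filt R x (d + 1) := by
  induction hu using Submodule.span_induction with
  | mem u h =>
    obtain ⟨l, hl, rfl⟩ := h
    rw [← word_cons]
    exact word_mem x (by simpa using hl)
  | zero => simp
  | add u v _ _ hu hv => rw [mul_add]; exact add_mem hu hv
  | smul r u _ hu => rw [mul_smul_comm]; exact Submodule.smul_mem _ _ hu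

lemma lie_mul_mem_filt {n : ℕ} (x : Fin n → L) (hx : Submodule.span R (Set.range x) = ⊤) (y : L)
    {d : ℕ} {u : UniversalEnvelopingAlgebra R L} (hu : u ∈ filt R x d) :
    UniversalEnvelopingAlgebra.ι R y * u ∈ filt R x (d + 1) := by
  have hy : y ∈ Submodule.span R (Set.range x) := hx ▸ Submodule.mem_top
  induction hy using Submodule.span_induction with
  | mem y h => obtain ⟨i, rfl⟩ := h; exact mul_mem_filt x i hu
  | zero => simp
  | add y z _ _ hy hz => rw [map_add, add_mul]; exact add_mem hy hz
  | smul r y _ hy => rw [map_smul, smul_mul_assoc]; exact Submodule.smul_mem _ _ hy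

lemma word_sub_word_mem {n : ℕ} (x : Fin n → L) (hx : Submodule.span R (Set.range x) = ⊤)
    {l l' : List (Fin n)} (h : l.Perm l') :
    word (R := R) x l - word x l' ∈ filt R x l.length := by
  induction h with
  | nil => simp
  | cons i _ ih =>
    rw [word_cons, word_cons, ← mul_sub]
    exact mul_mem_filt x i ih
  | swap i j l =>
    have : word (R := R) x (j :: i :: l) - word x (i :: j :: l)
        = UniversalEnvelopingAlgebra.ι R ⁅x j, x i⁆ * word x l := by
      simp only [word_cons, LieHom.map_lie, LieRing.of_associative_ring_bracket]
      noncomm_ring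
    rw [this]
    exact lie_mul_mem_filt x hx _ (word_mem x (by simp))
  | trans h₁ _ ih₁ ih₂ =>
    rw [← sub_add_sub_cancel]
    exact add_mem ih₁ (h₁.length_eq ▸ ih₂)

/-- The linear map from polynomials to `U(L)` sending a monomial to the word in its variables,
taken in some order. -/
noncomputable def symb (R : Type*) {L : Type*} [CommRing R] [LieRing L] [LieAlgebra R L]
    {n : ℕ} (x : Fin n → L) : MvPolynomial (Fin n) R →ₗ[R] UniversalEnvelopingAlgebra R L :=
  (MvPolynomial.basisMonomials (Fin n) R).constr R fun s => word x s.toMultiset.toList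

lemma symb_monomial {n : ℕ} (x : Fin n → L) (s : Fin n →₀ ℕ) :
    symb R x (monomial s 1) = word x s.toMultiset.toList := by
  have h : (monomial s (1 : R)) = MvPolynomial.basisMonomials (Fin n) R s := by simp
  rw [symb, h, Module.Basis.constr_basis]

lemma IsHomogeneous.mem_span {n d : ℕ} {p : MvPolynomial (Fin n) R} (hp : p.IsHomogeneous d) :
    p ∈ Submodule.span R ((fun s => monomial s (1 : R)) '' {s : Fin n →₀ ℕ | s.degree = d}) := by
  rw [p.as_sum]
  refine Submodule.sum_mem _ fun s hs => ?_
  have : monomial s (coeff s p) = coeff s p • monomial s (1 : R) := by simp [smul_monomial]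
  rw [this]
  refine Submodule.smul_mem _ _ (Submodule.subset_span ⟨s, ?_, rfl⟩)
  by_contra h
  exact (mem_support_iff.mp hs) (hp.coeff_eq_zero h)

lemma length_toList {n : ℕ} (s : Fin n →₀ ℕ) : s.toMultiset.toList.length = s.degree := by
  simp [Finsupp.card_toMultiset, Finsupp.degree_apply, Finsupp.sum]

lemma symb_mem {n d : ℕ} (x : Fin n → L) {p : MvPolynomial (Fin n) R}
    (hp : p.IsHomogeneous d) : symb R x p ∈ filt R x (d + 1) := by
  have hs := IsHomogeneous.mem_span hp
  clear hp
  induction hs using Submodule.span_induction with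
  | mem p h =>
    obtain ⟨s, hs, rfl⟩ := h
    have hs : s.degree = d := hs
    simp only [symb_monomial]
    exact word_mem x (by rw [length_toList]; omega)
  | zero => simp
  | add u v _ _ hu hv => rw [map_add]; exact add_mem hu hv
  | smul r u _ hu => rw [map_smul]; exact Submodule.smul_mem _ _ hu

lemma mul_symb_sub_mem {n d : ℕ} (x : Fin n → L) (hx : Submodule.span R (Set.range x) = ⊤)
    (i : Fin n) {p : MvPolynomial (Fin n) R} (hp : p.IsHomogeneous d) :
    UniversalEnvelopingAlgebra.ι R (x i) * symb R x p - symb R x (p * X i) ∈ filt R x (d + 1) := by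
  have hs := IsHomogeneous.mem_span hp
  clear hp
  induction hs using Submodule.span_induction with
  | mem p h =>
    obtain ⟨s, hs, rfl⟩ := h
    have hs : s.degree = d := hs
    have h1 : monomial s (1 : R) * X i = monomial (s + Finsupp.single i 1) 1 := by
      rw [X, monomial_mul, one_mul]
    simp only [h1, symb_monomial]
    rw [← word_cons]
    have hperm : (i :: s.toMultiset.toList).Perm
        (s + Finsupp.single i 1).toMultiset.toList := by
      rw [← Multiset.coe_eq_coe]
      simp [← Multiset.cons_coe, ← Multiset.singleton_add, add_comm]
    have := word_sub_word_mem (R := R) x hx hperm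
    rwa [List.length_cons, length_toList, hs] at this
  | zero => simp
  | add u v _ _ hu hv =>
    rw [map_add, add_mul, map_add, mul_add, add_sub_add_comm]; exact add_mem hu hv
  | smul r u _ hu =>
    rw [map_smul, smul_mul_assoc, map_smul, mul_smul_comm, ← smul_sub]
    exact Submodule.smul_mem _ _ hu

lemma exists_mem_filt {n : ℕ} (x : Fin n → L) (hx : Submodule.span R (Set.range x) = ⊤)
    (u : UniversalEnvelopingAlgebra R L) : ∃ d, u ∈ filt R x d := by
  have hmono : Monotone (filt R x) := fun a b h =>
    Submodule.span_mono (Set.image_mono fun l hl => lt_of_lt_of_le hl h)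
  have key : ∀ t : TensorAlgebra R L, ∀ w : UniversalEnvelopingAlgebra R L,
      (∃ d, w ∈ filt R x d) → ∃ d, mkAlgHom R L t * w ∈ filt R x d := by
    intro t
    induction t using TensorAlgebra.induction with
    | algebraMap r =>
      rintro w ⟨d, hd⟩
      refine ⟨d, ?_⟩
      rw [AlgHom.commutes, ← Algebra.smul_def]
      exact Submodule.smul_mem _ _ hd
    | ι y =>
      rintro w ⟨d, hd⟩
      exact ⟨d + 1, lie_mul_mem_filt x hx y hd⟩
    | mul a b ha hb =>
      intro w hw
      rw [map_mul, mul_assoc]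
      exact ha _ (hb _ hw)
    | add a b ha hb =>
      intro w hw
      obtain ⟨d, hd⟩ := ha w hw
      obtain ⟨e, he⟩ := hb w hw
      refine ⟨max d e, ?_⟩
      rw [map_add, add_mul]
      exact add_mem (hmono (le_max_left _ _) hd) (hmono (le_max_right _ _) he)
  obtain ⟨t, rfl⟩ : ∃ t, mkAlgHom R L t = u := RingCon.mk'_surjective (c := ringCon R L) u
  have := key t 1 ⟨1, by simpa [word] using word_mem (R := R) x (l := []) (d := 1) (by simp)⟩
  simpa using this

/-- The ideal of leading terms of a left ideal of `U(L)`. -/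
noncomputable def lead {n : ℕ} (x : Fin n → L) (hx : Submodule.span R (Set.range x) = ⊤)
    (I : Ideal (UniversalEnvelopingAlgebra R L)) : Ideal (MvPolynomial (Fin n) R) where
  carrier := {p | ∀ d, ∃ u ∈ I, u - symb R x (homogeneousComponent d p) ∈ filt R x d}
  zero_mem' d := ⟨0, by simp, by simp⟩
  add_mem' {p q} hp hq d := by
    obtain ⟨u, hu, hu'⟩ := hp d
    obtain ⟨v, hv, hv'⟩ := hq d
    refine ⟨u + v, add_mem hu hv, ?_⟩
    rw [map_add, map_add, add_sub_add_comm]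
    exact add_mem hu' hv'
  smul_mem' q p hp := by
    have hC : ∀ (r : R) (p : MvPolynomial (Fin n) R),
        (∀ d, ∃ u ∈ I, u - symb R x (homogeneousComponent d p) ∈ filt R x d) →
        ∀ d, ∃ u ∈ I, u - symb R x (homogeneousComponent d (C r * p)) ∈ filt R x d := by
      intro r p hp d
      obtain ⟨u, hu, hu'⟩ := hp d
      refine ⟨algebraMap R _ r * u, I.mul_mem_left _ hu, ?_⟩
      rw [homogeneousComponent_C_mul, ← smul_eq_C_mul, map_smul, ← Algebra.smul_def, ← smul_sub]
      exact Submodule.smul_mem _ _ hu'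
    have hX : ∀ (i : Fin n) (p : MvPolynomial (Fin n) R),
        (∀ d, ∃ u ∈ I, u - symb R x (homogeneousComponent d p) ∈ filt R x d) →
        ∀ d, ∃ u ∈ I, u - symb R x (homogeneousComponent d (p * X i)) ∈ filt R x d := by
      intro i p hp d
      cases d with
      | zero =>
        refine ⟨0, I.zero_mem, ?_⟩
        simp [homogeneousComponent_zero, coeff_mul_X']
      | succ d =>
        obtain ⟨u, hu, hu'⟩ := hp d
        refine ⟨UniversalEnvelopingAlgebra.ι R (x i) * u, I.mul_mem_left _ hu, ?_⟩
        have hc : homogeneousComponent (d + 1) (p * X i) = homogeneousComponent d p * X i := by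
          ext s
          simp only [coeff_homogeneousComponent, coeff_mul_X']
          by_cases hs : i ∈ s.support
          · have h0 : s = (s - Finsupp.single i 1) + Finsupp.single i 1 := by
              ext j
              by_cases hj : i = j
              · subst hj
                have := Finsupp.mem_support_iff.mp hs
                simp; omega
              · simp [hj]
            have h1 : s.degree = (s - Finsupp.single i 1).degree + 1 := by
              conv_lhs => rw [h0]
              simp
            simp [hs, h1]
          · simp [hs]
        rw [hc, ← sub_add_sub_cancel _ (UniversalEnvelopingAlgebra.ι R (x i)
          * symb R x (homogeneousComponent d p)), ← mul_sub]
        exact add_mem (mul_mem_filt x i hu')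
          (mul_symb_sub_mem x hx i (homogeneousComponent_isHomogeneous _ _))
    change ∀ d, ∃ u ∈ I, u - symb R x (homogeneousComponent d (q * p)) ∈ filt R x d
    induction q using MvPolynomial.induction_on generalizing p with
    | C a => exact hC a p hp
    | add a b ha hb =>
      intro d
      obtain ⟨u, hu, hu'⟩ := ha p hp d
      obtain ⟨v, hv, hv'⟩ := hb p hp d
      refine ⟨u + v, add_mem hu hv, ?_⟩
      rw [add_mul, map_add, map_add, add_sub_add_comm]
      exact add_mem hu' hv'
    | mul_X a i ha =>
      rw [mul_right_comm]
      exact hX i _ (ha p hp)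

lemma exists_symb {n : ℕ} (x : Fin n → L) (d : ℕ) {u : UniversalEnvelopingAlgebra R L}
    (hu : u ∈ filt R x (d + 1)) (hx : Submodule.span R (Set.range x) = ⊤) :
    ∃ p : MvPolynomial (Fin n) R, p.IsHomogeneous d ∧ u - symb R x p ∈ filt R x d := by
  induction hu using Submodule.span_induction with
  | mem u h =>
    obtain ⟨l, hl, rfl⟩ := h
    rcases Nat.lt_succ_iff_lt_or_eq.mp hl with hl | hl
    · exact ⟨0, isHomogeneous_zero _ _ _, by simpa using word_mem x hl⟩
    · have hp : l.Perm (Multiset.toFinsupp (l : Multiset (Fin n))).toMultiset.toList := by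
        rw [← Multiset.coe_eq_coe]; simp
      refine ⟨monomial (Multiset.toFinsupp (l : Multiset (Fin n))) 1,
        isHomogeneous_monomial _ ?_, ?_⟩
      · rw [← length_toList, ← hp.length_eq, hl]
      · rw [symb_monomial]
        exact hl ▸ word_sub_word_mem x hx hp
  | zero => exact ⟨0, isHomogeneous_zero _ _ _, by simp⟩
  | add u v _ _ hu hv =>
    obtain ⟨p, hp, hp'⟩ := hu
    obtain ⟨q, hq, hq'⟩ := hv
    refine ⟨p + q, hp.add hq, ?_⟩
    rw [map_add, add_sub_add_comm]
    exact add_mem hp' hq'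
  | smul r u _ hu =>
    obtain ⟨p, hp, hp'⟩ := hu
    refine ⟨r • p, (homogeneousSubmodule (Fin n) R d).smul_mem r hp, ?_⟩
    rw [map_smul, ← smul_sub]
    exact Submodule.smul_mem _ _ hp'

/-- The universal enveloping algebra of a Lie algebra that is finitely generated as a module over
a noetherian commutative ring is left noetherian. -/
theorem isNoetherianRing_universalEnvelopingAlgebra [IsNoetherianRing R] [Module.Finite R L] :
    IsNoetherianRing (UniversalEnvelopingAlgebra R L) := by
  obtain ⟨n, x, hx⟩ := Module.Finite.exists_fin (R := R) (M := L)
  rw [isNoetherianRing_iff, isNoetherian_iff']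
  refine StrictMono.wellFoundedGT (f := lead (R := R) x hx) fun I J hIJ => ?_
  have hle : lead x hx I ≤ lead x hx J := fun p hp d => by
    obtain ⟨u, hu, hu'⟩ := hp d
    exact ⟨u, hIJ.le hu, hu'⟩
  refine lt_of_le_of_ne hle fun heq => hIJ.not_ge ?_
  have key : ∀ d, ∀ u ∈ J, u ∈ filt R x d → u ∈ I := by
    intro d
    induction d with
    | zero =>
      intro u _ hu
      have : u = 0 := by simpa [filt] using hu
      exact this ▸ I.zero_mem
    | succ d ih =>
      intro u hu hud
      obtain ⟨p, hp, hp'⟩ := exists_symb x d hud hx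
      have hpJ : p ∈ lead x hx J := fun e => by
        by_cases he : e = d
        · subst he
          rw [homogeneousComponent_eq_self hp]
          exact ⟨u, hu, hp'⟩
        · rw [homogeneousComponent_of_mem hp, if_neg he]
          exact ⟨0, J.zero_mem, by simp⟩
      rw [← heq] at hpJ
      obtain ⟨w, hw, hw'⟩ := hpJ d
      rw [homogeneousComponent_eq_self hp] at hw'
      have : u - w ∈ I := ih _ (sub_mem hu (hIJ.le hw)) (by
        have := sub_mem hp' hw'
        simpa using this)
      simpa using add_mem this hw
  intro u hu
  obtain ⟨d, hd⟩ := exists_mem_filt x hx u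
  exact key d u hu hd

end Noetherian

/-! ### The Takiff Lie algebra of `sl₂` -/

open CategoryTheory CategoryTheory.Abelian
open scoped TensorProduct

attribute [local instance] LieRing.ofAssociativeRing

/-- The simple Lie algebra `sl₂` of traceless complex `2 × 2` matrices. -/
def Sl2 : Type := LieAlgebra.SpecialLinear.sl (Fin 2) ℂ

noncomputable instance : LieRing Sl2 :=
  inferInstanceAs (LieRing (LieAlgebra.SpecialLinear.sl (Fin 2) ℂ))

noncomputable instance : LieAlgebra ℂ Sl2 :=
  inferInstanceAs (LieAlgebra ℂ (LieAlgebra.SpecialLinear.sl (Fin 2) ℂ))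

/-- `e`, with `[e, f] = h`, `[h, e] = 2e`, `[h, f] = -2f`. -/
def e : Sl2 := ⟨!![0, 1; 0, 0], by simp [LieAlgebra.SpecialLinear.sl]⟩

/-- `h`. -/
def h : Sl2 := ⟨!![1, 0; 0, -1], by simp [LieAlgebra.SpecialLinear.sl]⟩

/-- `f`. -/
def f : Sl2 := ⟨!![0, 0; 1, 0], by simp [LieAlgebra.SpecialLinear.sl]⟩

/-- The complex Lie algebra `A ⊗ L`, for a commutative `ℂ`-algebra `A` and a complex Lie algebra
`L`, with bracket `[s ⊗ a, t ⊗ b] = st ⊗ [a, b]`. -/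
abbrev TensorLie (A L : Type) [CommRing A] [Algebra ℂ A] [LieRing L] [LieAlgebra ℂ L] : Type :=
  A ⊗[ℂ] L

/-- The Takiff Lie algebra `𝔤 = D ⊗ sl₂` over `ℂ`, where `D = ℂ[x]/(x²)` is the algebra of dual
numbers. -/
abbrev G : Type := TensorLie (DualNumber ℂ) Sl2

/-- `a` in `sl₂`, as the element `1 ⊗ a` of `𝔤`. -/
noncomputable def up (a : Sl2) : G := (1 : DualNumber ℂ) ⊗ₜ[ℂ] a

/-- The element `ā = x ⊗ a` of `𝔤`. -/
noncomputable def bar (a : Sl2) : G := (DualNumber.eps : DualNumber ℂ) ⊗ₜ[ℂ] a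

/-- The Cartan subalgebra of `𝔤`, generated by `h` and `x ⊗ h`. -/
noncomputable def cartan : LieSubalgebra ℂ G := LieSubalgebra.lieSpan ℂ G {up h, bar h}

/-- The subalgebra of `𝔤` generated by `e` and `x ⊗ e`. -/
noncomputable def nPlus : LieSubalgebra ℂ G := LieSubalgebra.lieSpan ℂ G {up e, bar e}

/-- The Borel subalgebra `b̄` of `𝔤`: the sum of `cartan` and `nPlus`, with linear basis
`h, x ⊗ h, e, x ⊗ e`. -/
noncomputable def borel : LieSubalgebra ℂ G := cartan ⊔ nPlus

/-- The universal enveloping algebra of a complex Lie algebra. -/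
abbrev U (L : Type*) [LieRing L] [LieAlgebra ℂ L] := UniversalEnvelopingAlgebra ℂ L

/-- The algebra homomorphism `U(b̄) → U(𝔤)` extending the inclusion `b̄ ⊆ 𝔤`. -/
noncomputable def borelMap : U borel →ₐ[ℂ] U G :=
  UniversalEnvelopingAlgebra.lift ℂ ((UniversalEnvelopingAlgebra.ι ℂ).comp borel.incl)

/-- A module `M` over a `ℂ`-algebra `A` is locally finite if `A m` is finite dimensional over `ℂ`
for every `m` in `M`. -/
def IsLocallyFinite (A M : Type*) [Ring A] [Algebra ℂ A] [AddCommGroup M] [Module A M]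
    [Module ℂ M] [IsScalarTower ℂ A M] : Prop :=
  ∀ m : M, FiniteDimensional ℂ (Submodule.span A {m})

open scoped ModuleCat in
/-- Thick category `O`: the `𝔤`-modules that are finitely generated (over `U(𝔤)`) and on which
`U(b̄)` acts locally finitely. -/
def thickO : ObjectProperty (ModuleCat.{v} (U G)) := fun M =>
  Module.Finite (U G) M ∧
    IsLocallyFinite (U borel) ((ModuleCat.restrictScalars borelMap.toRingHom).obj M)

/-! ### Thick category `O` is an abelian category with exact inclusion -/

lemma IsLocallyFinite.of_injective {A M N : Type*} [Ring A] [Algebra ℂ A] [AddCommGroup M]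
    [Module A M] [Module ℂ M] [IsScalarTower ℂ A M] [AddCommGroup N] [Module A N] [Module ℂ N]
    [IsScalarTower ℂ A N] (φ : M →ₗ[A] N) (hφ : Function.Injective φ)
    (hN : IsLocallyFinite A N) : IsLocallyFinite A M := fun m => by
  have := hN (φ m)
  have hm : ∀ y ∈ Submodule.span A {m}, φ y ∈ Submodule.span A {φ m} := fun y hy => by
    rw [← Set.image_singleton, ← Submodule.map_span]
    exact Submodule.mem_map_of_mem hy
  refine FiniteDimensional.of_injective ((φ.restrict hm).restrictScalars ℂ) fun a b hab => ?_
  exact Subtype.ext (hφ (congrArg Subtype.val hab))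

lemma IsLocallyFinite.of_surjective {A M N : Type*} [Ring A] [Algebra ℂ A] [AddCommGroup M]
    [Module A M] [Module ℂ M] [IsScalarTower ℂ A M] [AddCommGroup N] [Module A N] [Module ℂ N]
    [IsScalarTower ℂ A N] (φ : M →ₗ[A] N) (hφ : Function.Surjective φ)
    (hM : IsLocallyFinite A M) : IsLocallyFinite A N := fun n => by
  obtain ⟨m, rfl⟩ := hφ n
  have := hM m
  have hm : ∀ y ∈ Submodule.span A {m}, φ y ∈ Submodule.span A {φ m} := fun y hy => by
    rw [← Set.image_singleton, ← Submodule.map_span]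
    exact Submodule.mem_map_of_mem hy
  refine Module.Finite.of_surjective ((φ.restrict hm).restrictScalars ℂ) fun ⟨b, hb⟩ => ?_
  obtain ⟨a, rfl⟩ := Submodule.mem_span_singleton.mp hb
  exact ⟨⟨a • m, Submodule.smul_mem _ _ (Submodule.mem_span_singleton_self m)⟩,
    Subtype.ext (map_smul φ a m)⟩

lemma IsLocallyFinite.of_jointly_injective {A M N P : Type*} [Ring A] [Algebra ℂ A]
    [AddCommGroup M] [Module A M] [Module ℂ M] [IsScalarTower ℂ A M]
    [AddCommGroup N] [Module A N] [Module ℂ N] [IsScalarTower ℂ A N]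
    [AddCommGroup P] [Module A P] [Module ℂ P] [IsScalarTower ℂ A P]
    (φ : P →ₗ[A] M) (ψ : P →ₗ[A] N) (hφψ : ∀ p, φ p = 0 → ψ p = 0 → p = 0)
    (hM : IsLocallyFinite A M) (hN : IsLocallyFinite A N) : IsLocallyFinite A P := fun p => by
  have := hM (φ p)
  have := hN (ψ p)
  have hφ : ∀ y ∈ Submodule.span A {p}, φ y ∈ Submodule.span A {φ p} := fun y hy => by
    rw [← Set.image_singleton, ← Submodule.map_span]
    exact Submodule.mem_map_of_mem hy
  have hψ : ∀ y ∈ Submodule.span A {p}, ψ y ∈ Submodule.span A {ψ p} := fun y hy => by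
    rw [← Set.image_singleton, ← Submodule.map_span]
    exact Submodule.mem_map_of_mem hy
  refine FiniteDimensional.of_injective
    (((φ.restrict hφ).restrictScalars ℂ).prod ((ψ.restrict hψ).restrictScalars ℂ)) ?_
  rw [injective_iff_map_eq_zero]
  intro a ha
  have h1 := congrArg (fun z => (z.1 : M)) ha
  have h2 := congrArg (fun z => (z.2 : N)) ha
  exact Subtype.ext (hφψ a.1 h1 h2)

instance : Module.Finite ℂ (DualNumber ℂ) := inferInstanceAs (Module.Finite ℂ (ℂ × ℂ))

instance : Module.Finite ℂ Sl2 :=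
  inferInstanceAs (Module.Finite ℂ (LieAlgebra.SpecialLinear.sl (Fin 2) ℂ).toSubmodule)

instance : IsNoetherianRing (U G) := isNoetherianRing_universalEnvelopingAlgebra

instance : thickO.{v}.IsClosedUnderSubobjects where
  prop_of_mono {X Y} φ _ hY := by
    have hφ := (ModuleCat.mono_iff_injective φ).mp inferInstance
    have := hY.1
    open scoped ModuleCat in
    exact ⟨Module.Finite.of_injective φ.hom hφ, IsLocallyFinite.of_injective
      ((ModuleCat.restrictScalars borelMap.toRingHom).map φ).hom hφ hY.2⟩

instance : thickO.{v}.IsClosedUnderQuotients where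
  prop_of_epi {X Y} φ _ hX := by
    have hφ := (ModuleCat.epi_iff_surjective φ).mp inferInstance
    have := hX.1
    open scoped ModuleCat in
    exact ⟨Module.Finite.of_surjective φ.hom hφ, IsLocallyFinite.of_surjective
      ((ModuleCat.restrictScalars borelMap.toRingHom).map φ).hom hφ hX.2⟩

instance : thickO.{v}.ContainsZero where
  exists_zero := by
    refine ⟨ModuleCat.of (U G) PUnit, ModuleCat.isZero_of_subsingleton _, ?_, fun m => ?_⟩
    · change Module.Finite (U G) PUnit.{v + 1}
      infer_instance
    · have : Subsingleton ((ModuleCat.restrictScalars borelMap.toRingHom).obj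
        (ModuleCat.of (U G) PUnit.{v + 1})) := inferInstanceAs (Subsingleton PUnit.{v + 1})
      infer_instance

instance : thickO.{v}.IsClosedUnderFiniteProducts := by
  have : thickO.{v}.IsClosedUnderBinaryProducts := ⟨by
    rintro X ⟨p⟩
    let φ := p.π.app ⟨.left⟩
    let ψ := p.π.app ⟨.right⟩
    have hl := p.prop_diag_obj ⟨.left⟩
    have hr := p.prop_diag_obj ⟨.right⟩
    have hinj : ∀ x : X, φ.hom x = 0 → ψ.hom x = 0 → x = 0 := by
      intro x h1 h2
      let g : ModuleCat.of (U G) (ULift.{v} (U G)) ⟶ X :=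
        ModuleCat.ofHom ((LinearMap.toSpanSingleton (U G) X x).comp ULift.moduleEquiv.toLinearMap)
      have hg : g = 0 := p.isLimit.hom_ext (by
        rintro ⟨_ | _⟩
        · have : g ≫ φ = 0 := by
            ext y
            change φ.hom (y.down • x) = 0
            rw [map_smul, h1, smul_zero]
          exact this.trans Limits.zero_comp.symm
        · have : g ≫ ψ = 0 := by
            ext y
            change ψ.hom (y.down • x) = 0
            rw [map_smul, h2, smul_zero]
          exact this.trans Limits.zero_comp.symm)
      have := congrArg (fun k => k.hom ⟨1⟩) hg
      simpa [g] using this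
    have := hl.1
    have := hr.1
    have hprod : Function.Injective (φ.hom.prod ψ.hom) := by
      rw [injective_iff_map_eq_zero]
      intro a ha
      exact hinj a (congrArg Prod.fst ha) (congrArg Prod.snd ha)
    open scoped ModuleCat in
    exact ⟨Module.Finite.of_injective _ hprod, IsLocallyFinite.of_jointly_injective
      ((ModuleCat.restrictScalars borelMap.toRingHom).map φ).hom
      ((ModuleCat.restrictScalars borelMap.toRingHom).map ψ).hom hinj hl.2 hr.2⟩⟩
  exact .mk'

/-- Thick category `O` as a category: a full subcategory of all `𝔤`-modules. -/
abbrev ThickO : Type (v + 1) := thickO.{v}.FullSubcategory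

instance : Limits.PreservesFiniteLimits thickO.{v}.ι := by
  have := thickO.{v}.preservesKernels_ι
  exact Functor.preservesFiniteLimits_of_preservesKernels _
instance : Limits.PreservesFiniteColimits thickO.{v}.ι := by
  have := thickO.{v}.preservesCokernels_ι
  exact Functor.preservesFiniteColimits_of_preservesCokernels _

instance : HasExt.{v + 1} ThickO.{v} := HasExt.standard _

end Takiff

/-! An exact fully faithful functor of abelian categories induces isomorphisms on all Ext groups as
soon as each class of positive degree between objects of its image dies after pullback along the
image of an epimorphism. Surjectivity follows by dimension shifting along the kernel; injectivity
follows likewise, because classes inside the source category are always effaceable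
(`mapExt_bijective_of_effaceable`). So, for M and N in thick O, each e in Ext^{n+1} over 𝔤 has to be
killed by an epimorphism P → M of thick O.

Write Ind for induction from b̄ to 𝔤. Local finiteness makes M a quotient of Ind V with V finite
dimensional, and Ind V lies in thick O, so M may be replaced by Ind V. Embed N in an injective
𝔤-module I. Then N lies in the largest b̄-locally finite submodule Γ(I) (`gamma`), and Γ(I) is
injective over b̄ for two reasons. By PBW, induction is exact, so I is injective over b̄
(`baer_res`). By an Artin-Rees property of U(b̄), finitely generated essential extensions of finite
dimensional b̄-modules are finite dimensional (`finiteDimensional_of_isEssential`), so the locally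
finite part stays injective (`baer_gamma`). A Shapiro argument then gives Ext^{>0}(Ind V, Γ(I)) = 0
(`ext_ind_eq_zero`).

Shifting along 0 → N → Γ(I) → Q → 0 reduces e to degree one, where it comes from a map f : Ind V →
Q. A finite dimensional b̄-submodule W of the fibre product of V and Γ(I) over Q still surjects onto
V, and f lifts to Γ(I) after restriction to Ind W (`exists_lift_of_surjective`). Hence Ind W → Ind V
kills e (`exists_indMap_comp_eq_zero`). Γ(I) and Q need not be finitely generated; only the covers
Ind W have to lie in thick O.

The PBW input is that U(𝔤) is free as a right U(b̄)-module on the monomials fⁱ(x ⊗ f)ʲ. Independence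
is read off from an explicit action of 𝔤 by differential operators on power series with coefficients
in U(b̄). -/

namespace Takiff

/-! ### Effaceability and comparison of Ext groups. -/

section ExtensionFull

open CategoryTheory Limits Category Abelian DerivedCategory HomologicalComplex

universe w w' u u' v₁ v₂

variable {C : Type u} [Category.{v₁} C] [Abelian C]

/-- A quasi-isomorphism at `i` from a complex in degrees `≤ i` to a single complex is, up to
precomposition with a morphism from a single complex, an epimorphism in the category. -/
lemma exists_epi_of_quasiIsoAt {X : C} {K : CochainComplex C ℤ} {i : ℤ}
    (π : K ⟶ (single C (ComplexShape.up ℤ) i).obj X) [K.IsStrictlyLE i] [QuasiIsoAt π i] :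
    ∃ (P : C) (p : P ⟶ X) (_ : Epi p) (t : (single C (ComplexShape.up ℤ) i).obj P ⟶ K),
      t ≫ π = (single C (ComplexShape.up ℤ) i).map p := by
  -- Since `K` vanishes in degree `i + 1`, all of `K.X i` consists of cycles, so it maps onto the
  -- homology, which maps onto `X`.
  let e := K.iCyclesIso i (i + 1) (by simp)
    ((K.isZero_of_isStrictlyLE i (i + 1) (by simp)).eq_of_tgt _ _)
  let α := e.inv ≫ K.homologyπ i ≫ homologyMap π i ≫ (singleObjHomologySelfIso _ _ _).hom
  have hα : Epi α := by
    have : Epi (homologyMap π i ≫ (singleObjHomologySelfIso _ i X).hom) := epi_comp _ _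
    have : Epi (K.homologyπ i ≫ homologyMap π i ≫ (singleObjHomologySelfIso _ i X).hom) :=
      epi_comp _ _
    exact epi_comp _ _
  have h : π.f i = α ≫ (singleObjXSelf (ComplexShape.up ℤ) i X).inv := by
    rw [← cancel_epi e.hom]
    have h₁ : e.hom ≫ α = K.homologyπ i ≫ homologyMap π i ≫
        (singleObjHomologySelfIso _ _ _).hom := e.hom_inv_id_assoc _
    rw [← assoc, h₁, assoc, assoc, homologyπ_naturality_assoc,
      homologyπ_singleObjHomologySelfIso_hom_assoc, ← singleObjCyclesSelfIso_inv_iCycles,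
      Iso.hom_inv_id_assoc]
    exact (cyclesMap_i π i).symm
  refine ⟨K.X i, α, hα, mkHomFromSingle (𝟙 _) (by
      intro k hk
      obtain rfl : i + 1 = k := hk
      exact (K.isZero_of_isStrictlyLE i (i + 1) (by simp)).eq_of_tgt _ _), ?_⟩
  apply HomologicalComplex.from_single_hom_ext
  rw [comp_f, mkHomFromSingle_f, h, single_map_f_self, comp_id, assoc]

variable [HasExt.{w} C]

/-- Extension classes of positive degree are effaceable: each is killed by an epimorphism. -/
lemma exists_epi_comp_eq_zero {X Y : C} {n : ℕ} (e : Ext X Y (n + 1)) :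
    ∃ (P : C) (p : P ⟶ X) (_ : Epi p), (Ext.mk₀ p).comp e (zero_add _) = 0 := by
  let := HasDerivedCategory.standard C
  let φ : Q.obj ((CochainComplex.singleFunctor C 0).obj X) ⟶
      Q.obj ((CochainComplex.singleFunctor C (-(n + 1))).obj Y) :=
    e.hom ≫ ((DerivedCategory.singleFunctors C).shiftIso (n + 1) (-(n + 1)) 0
      (by lia)).hom.app _
  -- The class is a roof X ← K → Y[n+1] whose left leg is a quasi-isomorphism and whose apex lives
  -- in degrees ≤ 0. The degree 0 term of `K` is the required cover of X.
  obtain ⟨K, _, π, h, g, hφ⟩ := right_fac_of_isStrictlyLE φ 0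
  have h' : QuasiIso π := by rwa [isIso_Q_map_iff_quasiIso] at h
  have h₀ : QuasiIsoAt π 0 := h'.quasiIsoAt 0
  obtain ⟨P, p, hp, t, ht⟩ : ∃ (P : C) (p : P ⟶ X) (_ : Epi p)
      (t : (CochainComplex.singleFunctor C 0).obj P ⟶ K),
      t ≫ π = (CochainComplex.singleFunctor C 0).map p :=
    @exists_epi_of_quasiIsoAt _ _ _ _ _ _ π _ h₀
  refine ⟨P, p, hp, ?_⟩
  -- The source lives in degree 0 and the target only in degree -(n+1).
  have h0 : t ≫ g = 0 := by
    apply HomologicalComplex.from_single_hom_ext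
    apply (((CochainComplex.singleFunctor C (-(n + 1))).obj Y).isZero_of_isStrictlyLE
      (-(n + 1)) 0 (by lia)).eq_of_tgt
  have h1 : Q.map ((CochainComplex.singleFunctor C 0).map p) ≫ φ = 0 := by
    rw [hφ, ← ht, Q.map_comp, assoc, IsIso.hom_inv_id_assoc, ← Q.map_comp, h0, Q.map_zero]
  apply Ext.homEquiv.injective
  simp only [← cancel_mono (((singleFunctors C).shiftIso (n + 1) (-(n + 1)) 0
    (by lia)).hom.app _), Ext.zero_hom, Limits.zero_comp]
  change (Ext.hom _) ≫ _ = _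
  rw [Ext.comp_hom, Ext.mk₀_hom]
  rw [ShiftedHom.mk₀_comp, assoc]
  exact h1

variable {D : Type u'} [Category.{v₂} D] [Abelian D]
  (F : C ⥤ D) [F.Additive] [PreservesFiniteLimits F] [PreservesFiniteColimits F]
  [HasExt.{w'} D]

/-- An exact fully faithful functor induces isomorphisms on `Ext` if every class of positive degree
between objects in its image is killed by the image of an epimorphism. -/
lemma mapExt_bijective_of_effaceable [F.Full] [F.Faithful]
    (hF : ∀ (X Y : C) (n : ℕ) (e : Ext (F.obj X) (F.obj Y) (n + 1)),
      ∃ (P : C) (p : P ⟶ X) (_ : Epi p), (Ext.mk₀ (F.map p)).comp e (zero_add _) = 0)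
    (X Y : C) (n : ℕ) : Function.Bijective (F.mapExtAddHom X Y n) := by
  induction n generalizing X with
  | zero => simpa [Ext.mapExactFunctor₀] using ⟨Functor.Faithful.map_injective, Functor.Full.map_surjective⟩
  | succ n hn =>
    refine ⟨(injective_iff_map_eq_zero _).mpr fun e he => ?_, fun e => ?_⟩
    · obtain ⟨P, p, _, hp⟩ := exists_epi_comp_eq_zero e
      let S := ShortComplex.mk _ _ (kernel.condition p)
      have hS : S.ShortExact := { exact := ShortComplex.exact_kernel p }
      -- The class is δ(a) with a on ker p. Since δ(F a) = 0, F a is the restriction of a class on F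
      -- P. By induction that class is F b; then b restricts to a, and δ kills restrictions from P.
      obtain ⟨a, rfl⟩ := Ext.contravariant_sequence_exact₃ hS _ e hp (add_comm 1 n)
      rw [Functor.mapExtAddHom_apply, Ext.mapExactFunctor_comp, Ext.mapExactFunctor_extClass] at he
      obtain ⟨b, hb⟩ := Ext.contravariant_sequence_exact₁ (hS.map_of_exact F) _ _ _ he
      obtain ⟨b, rfl⟩ := (hn P).2 b
      have : (Ext.mk₀ S.f).comp b (zero_add n) = a := (hn _).1 (by
        rw [Functor.mapExtAddHom_apply, Ext.mapExactFunctor_comp, Ext.mapExactFunctor_mk₀]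
        exact hb)
      rw [← this, ShortComplex.ShortExact.extClass_comp_assoc]
    · obtain ⟨P, p, _, hp⟩ := hF X Y n e
      let S := ShortComplex.mk _ _ (kernel.condition p)
      have hS : S.ShortExact := { exact := ShortComplex.exact_kernel p }
      obtain ⟨a, rfl⟩ := Ext.contravariant_sequence_exact₃ (hS.map_of_exact F) _ e hp (add_comm 1 n)
      obtain ⟨a, rfl⟩ := (hn _).2 a
      refine ⟨hS.extClass.comp a (add_comm 1 n), ?_⟩
      rw [Functor.mapExtAddHom_apply, Ext.mapExactFunctor_comp, Ext.mapExactFunctor_extClass]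
      rfl

end ExtensionFull

end Takiff

namespace Takiff

open scoped TensorProduct

attribute [local instance] LieRing.ofAssociativeRing

/-! ### Homomorphisms out of 𝔤 from values on a basis. -/

section Structure

/-- The coordinate of `e`. -/
noncomputable def coordE : Sl2 →ₗ[ℂ] ℂ where
  toFun a := a.1 0 1
  map_add' _ _ := rfl
  map_smul' _ _ := rfl

/-- The coordinate of `h`. -/
noncomputable def coordH : Sl2 →ₗ[ℂ] ℂ where
  toFun a := a.1 0 0
  map_add' _ _ := rfl
  map_smul' _ _ := rfl

/-- The coordinate of `f`. -/
noncomputable def coordF : Sl2 →ₗ[ℂ] ℂ where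
  toFun a := a.1 1 0
  map_add' _ _ := rfl
  map_smul' _ _ := rfl

lemma sl2_decomp (a : Sl2) : a = coordE a • e + coordH a • h + coordF a • f := by
  have ht : a.1 0 0 + a.1 1 1 = 0 := by
    have := a.2
    rw [← Matrix.trace_fin_two]
    exact this
  apply Subtype.ext
  change a.1 = a.1 0 1 • e.1 + a.1 0 0 • h.1 + a.1 1 0 • f.1
  ext i j
  fin_cases i <;> fin_cases j <;> simp [e, f, h]
  linear_combination ht

@[simp] lemma coordE_e : coordE e = 1 := rfl
@[simp] lemma coordE_h : coordE h = 0 := rfl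
@[simp] lemma coordE_f : coordE f = 0 := rfl
@[simp] lemma coordH_e : coordH e = 0 := rfl
@[simp] lemma coordH_h : coordH h = 1 := rfl
@[simp] lemma coordH_f : coordH f = 0 := rfl
@[simp] lemma coordF_e : coordF e = 0 := rfl
@[simp] lemma coordF_h : coordF h = 0 := rfl
@[simp] lemma coordF_f : coordF f = 1 := rfl

@[elab_as_elim]
lemma sl2_induction {P : Sl2 → Prop} (a : Sl2) (he : P e) (hh : P h) (hf : P f)
    (hadd : ∀ a b, P a → P b → P (a + b)) (hsmul : ∀ (c : ℂ) a, P a → P (c • a)) : P a := by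
  rw [sl2_decomp a]
  exact hadd _ _ (hadd _ _ (hsmul _ _ he) (hsmul _ _ hh)) (hsmul _ _ hf)

@[simp] lemma lie_e_f : ⁅e, f⁆ = h := by
  apply Subtype.ext
  change e.1 * f.1 - f.1 * e.1 = h.1
  simp [e, f, h]

@[simp] lemma lie_h_e : ⁅h, e⁆ = (2 : ℂ) • e := by
  apply Subtype.ext
  change h.1 * e.1 - e.1 * h.1 = (2 : ℂ) • e.1
  simp [e, h]
  norm_num

@[simp] lemma lie_h_f : ⁅h, f⁆ = (-2 : ℂ) • f := by
  apply Subtype.ext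
  change h.1 * f.1 - f.1 * h.1 = (-2 : ℂ) • f.1
  ext i j
  fin_cases i <;> fin_cases j <;> simp [f, h]
  norm_num

@[simp] lemma lie_f_e : ⁅f, e⁆ = -h := by rw [← lie_skew, lie_e_f]
@[simp] lemma lie_e_h : ⁅e, h⁆ = (-2 : ℂ) • e := by rw [← lie_skew, lie_h_e, neg_smul]
@[simp] lemma lie_f_h : ⁅f, h⁆ = (2 : ℂ) • f := by rw [← lie_skew, lie_h_f, neg_smul, neg_neg]

lemma lie_up_up (a b : Sl2) : ⁅up a, up b⁆ = up ⁅a, b⁆ := by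
  simp [up]

lemma lie_up_bar (a b : Sl2) : ⁅up a, bar b⁆ = bar ⁅a, b⁆ := by
  simp [up, bar]

lemma lie_bar_up (a b : Sl2) : ⁅bar a, up b⁆ = bar ⁅a, b⁆ := by
  simp [up, bar]

lemma lie_bar_bar (a b : Sl2) : ⁅bar a, bar b⁆ = 0 := by
  simp [bar]

lemma up_add (a b : Sl2) : up (a + b) = up a + up b := TensorProduct.tmul_add _ _ _
lemma bar_add (a b : Sl2) : bar (a + b) = bar a + bar b := TensorProduct.tmul_add _ _ _
lemma up_smul (c : ℂ) (a : Sl2) : up (c • a) = c • up a := TensorProduct.tmul_smul _ _ _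
lemma bar_smul (c : ℂ) (a : Sl2) : bar (c • a) = c • bar a := TensorProduct.tmul_smul _ _ _

lemma tmul_eq_up_add_bar (d : DualNumber ℂ) (a : Sl2) :
    (d ⊗ₜ[ℂ] a : G) = up (d.fst • a) + bar (d.snd • a) := by
  rw [up, bar, ← TensorProduct.smul_tmul, ← TensorProduct.smul_tmul, ← TensorProduct.add_tmul]
  congr 1
  ext <;> simp

lemma exists_eq_up_add_bar (x : G) : ∃ a b, x = up a + bar b := by
  induction x using TensorProduct.induction_on with
  | zero => exact ⟨0, 0, by simp [up, bar]⟩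
  | tmul d a => exact ⟨_, _, tmul_eq_up_add_bar d a⟩
  | add x y hx hy =>
    obtain ⟨a, b, rfl⟩ := hx
    obtain ⟨c, d, rfl⟩ := hy
    exact ⟨a + c, b + d, by rw [up_add, bar_add]; abel⟩

variable {A : Type*} [Ring A] [Algebra ℂ A]

/-- The Lie algebra homomorphism from `𝔤` given by two linear maps on `sl₂`. -/
noncomputable def lieHomOfPair (φ ψ : Sl2 →ₗ[ℂ] A)
    (h₀ : ∀ a b, φ ⁅a, b⁆ = φ a * φ b - φ b * φ a)
    (h₁ : ∀ a b, ψ ⁅a, b⁆ = φ a * ψ b - ψ b * φ a)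
    (h₂ : ∀ a b, ψ a * ψ b = ψ b * ψ a) : G →ₗ⁅ℂ⁆ A :=
  let Φ : G →ₗ[ℂ] A := TensorProduct.lift (LinearMap.mk₂ ℂ
    (fun (d : DualNumber ℂ) a => d.fst • φ a + d.snd • ψ a)
    (fun _ _ _ => by simp only [TrivSqZeroExt.fst_add, TrivSqZeroExt.snd_add]; module)
    (fun _ _ _ => by
      simp only [TrivSqZeroExt.fst_smul, TrivSqZeroExt.snd_smul, smul_eq_mul]; module)
    (fun _ _ _ => by simp only [map_add]; module)
    (fun _ _ _ => by simp only [map_smul]; module))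
  have hup : ∀ a, Φ (up a) = φ a := fun a => by simp [Φ, up]
  have hbar : ∀ a, Φ (bar a) = ψ a := fun a => by simp [Φ, bar]
  { Φ with
    map_lie' := by
      intro x y
      change Φ ⁅x, y⁆ = Φ x * Φ y - Φ y * Φ x
      obtain ⟨a, b, rfl⟩ := exists_eq_up_add_bar x
      obtain ⟨c, d, rfl⟩ := exists_eq_up_add_bar y
      have h₁' : ψ ⁅b, c⁆ = ψ b * φ c - φ c * ψ b := by
        rw [← lie_skew, map_neg, h₁, neg_sub]
      simp only [lie_add, add_lie, lie_up_up, lie_up_bar, lie_bar_up, lie_bar_bar, map_add, hup,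
        hbar, h₀, map_zero, add_mul, mul_add]
      rw [h₂ b d, h₁', h₁]
      abel }

lemma lieHomOfPair_up (φ ψ : Sl2 →ₗ[ℂ] A) (h₀ h₁ h₂ a) :
    lieHomOfPair φ ψ h₀ h₁ h₂ (up a) = φ a := by
  change TensorProduct.lift _ _ = _
  simp [up]

lemma lieHomOfPair_bar (φ ψ : Sl2 →ₗ[ℂ] A) (h₀ h₁ h₂ a) :
    lieHomOfPair φ ψ h₀ h₁ h₂ (bar a) = ψ a := by
  change TensorProduct.lift _ _ = _
  simp [bar]

/-- The linear map on `sl₂` with given values at `e`, `h` and `f`. -/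
noncomputable def ofBasis (x y z : A) : Sl2 →ₗ[ℂ] A :=
  coordE.smulRight x + coordH.smulRight y + coordF.smulRight z

@[simp] lemma ofBasis_e (x y z : A) : ofBasis x y z e = x := by simp [ofBasis]
@[simp] lemma ofBasis_h (x y z : A) : ofBasis x y z h = y := by simp [ofBasis]
@[simp] lemma ofBasis_f (x y z : A) : ofBasis x y z f = z := by simp [ofBasis]

/-- By bilinearity only the nine brackets of basis vectors matter. Keeping two triples apart lets
one lemma serve twice: with equal triples it gives the homomorphism property on `up`, with different
ones the equivariance of the `bar` part. -/
lemma ofBasis_lie {x y z : A} (φ : Sl2 →ₗ[ℂ] A) {x' y' z' : A} (hx : φ e = x') (hy : φ h = y')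
    (hz : φ f = z') (hxx : x * x' = x' * x) (hyy : y * y' = y' * y) (hzz : z * z' = z' * z)
    (hxz : x * z' - z' * x = y') (hzx : x' * z - z * x' = y')
    (hyx : y * x' - x' * y = (2 : ℂ) • x') (hxy : y' * x - x * y' = (2 : ℂ) • x')
    (hyz : y * z' - z' * y = (-2 : ℂ) • z') (hzy : y' * z - z * y' = (-2 : ℂ) • z')
    (a b : Sl2) : φ ⁅a, b⁆ = ofBasis x y z a * φ b - φ b * ofBasis x y z a := by
  subst hx hy hz
  induction a using sl2_induction with
  | hadd a c ha hc => rw [add_lie, map_add, ha, hc, map_add]; noncomm_ring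
  | hsmul c a ha => rw [smul_lie, map_smul, ha, map_smul, smul_mul_assoc, mul_smul_comm, smul_sub]
  | _ =>
    induction b using sl2_induction with
    | hadd a c ha hc => rw [lie_add, map_add, ha, hc, map_add]; noncomm_ring
    | hsmul c a ha => rw [lie_smul, map_smul, ha, map_smul, smul_mul_assoc, mul_smul_comm, smul_sub]
    | _ =>
      simp only [ofBasis_e, ofBasis_h, ofBasis_f, lie_self, map_zero, lie_e_f, lie_h_e, lie_h_f,
        lie_f_e, lie_e_h, lie_f_h, map_neg, map_smul]
      first
      | rw [hxx, sub_self] | rw [hyy, sub_self] | rw [hzz, sub_self] | rw [hxz] | rw [hyx]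
      | rw [hyz] | rw [← hzx, neg_sub] | rw [← neg_sub, hxy, neg_smul]
      | rw [← neg_sub, hzy, neg_smul, neg_neg]

lemma uea_induction {L : Type*} [LieRing L] [LieAlgebra ℂ L] {P : U L → Prop} (u : U L)
    (halg : ∀ c, P (algebraMap ℂ _ c)) (hι : ∀ x, P (UniversalEnvelopingAlgebra.ι ℂ x))
    (hmul : ∀ u v, P u → P v → P (u * v)) (hadd : ∀ u v, P u → P v → P (u + v)) : P u := by
  obtain ⟨t, rfl⟩ : ∃ t, UniversalEnvelopingAlgebra.mkAlgHom ℂ L t = u :=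
    RingCon.mk'_surjective (c := UniversalEnvelopingAlgebra.ringCon ℂ L) u
  induction t using TensorAlgebra.induction with
  | algebraMap r => rw [AlgHom.commutes]; exact halg r
  | ι y => exact hι y
  | mul a b ha hb => rw [map_mul]; exact hmul _ _ ha hb
  | add a b ha hb => rw [map_add]; exact hadd _ _ ha hb

end Structure

/-! ### A basis of b̄. -/

section Borel

lemma up_h_mem : up h ∈ borel :=
  (le_sup_left : cartan ≤ borel) (LieSubalgebra.subset_lieSpan (by simp))
lemma bar_h_mem : bar h ∈ borel :=
  (le_sup_left : cartan ≤ borel) (LieSubalgebra.subset_lieSpan (by simp))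
lemma up_e_mem : up e ∈ borel :=
  (le_sup_right : nPlus ≤ borel) (LieSubalgebra.subset_lieSpan (by simp))
lemma bar_e_mem : bar e ∈ borel :=
  (le_sup_right : nPlus ≤ borel) (LieSubalgebra.subset_lieSpan (by simp))

/-- `h` in `b̄`. -/
noncomputable def hb : borel := ⟨up h, up_h_mem⟩
/-- `x ⊗ h` in `b̄`. -/
noncomputable def hb' : borel := ⟨bar h, bar_h_mem⟩
/-- `e` in `b̄`. -/
noncomputable def eb : borel := ⟨up e, up_e_mem⟩
/-- `x ⊗ e` in `b̄`. -/
noncomputable def eb' : borel := ⟨bar e, bar_e_mem⟩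

lemma lie_hb_eb : ⁅hb, eb⁆ = (2 : ℂ) • eb := Subtype.ext (by
  change ⁅up h, up e⁆ = (2 : ℂ) • up e; rw [lie_up_up, lie_h_e, up_smul])
lemma lie_hb_eb' : ⁅hb, eb'⁆ = (2 : ℂ) • eb' := Subtype.ext (by
  change ⁅up h, bar e⁆ = (2 : ℂ) • bar e; rw [lie_up_bar, lie_h_e, bar_smul])
lemma lie_hb'_eb : ⁅hb', eb⁆ = (2 : ℂ) • eb' := Subtype.ext (by
  change ⁅bar h, up e⁆ = (2 : ℂ) • bar e; rw [lie_bar_up, lie_h_e, bar_smul])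
lemma lie_hb'_eb' : ⁅hb', eb'⁆ = 0 := Subtype.ext (lie_bar_bar h e)
lemma lie_hb_hb' : ⁅hb, hb'⁆ = 0 := Subtype.ext (by
  change ⁅up h, bar h⁆ = 0; rw [lie_up_bar, lie_self]; simp [bar])
lemma lie_eb_eb' : ⁅eb, eb'⁆ = 0 := Subtype.ext (by
  change ⁅up e, bar e⁆ = 0; rw [lie_up_bar, lie_self]; simp [bar])

/-- The span of `h, x ⊗ h, e, x ⊗ e` is a Lie subalgebra. -/
noncomputable def borelSpan : LieSubalgebra ℂ G where
  carrier := {x | ∃ a b c d : ℂ, x = a • up h + b • bar h + c • up e + d • bar e}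
  zero_mem' := ⟨0, 0, 0, 0, by simp⟩
  add_mem' := by
    rintro _ _ ⟨a, b, c, d, rfl⟩ ⟨a', b', c', d', rfl⟩
    exact ⟨a + a', b + b', c + c', d + d', by module⟩
  smul_mem' := by
    rintro r _ ⟨a, b, c, d, rfl⟩
    exact ⟨r * a, r * b, r * c, r * d, by module⟩
  lie_mem' := by
    rintro _ _ ⟨a, b, c, d, rfl⟩ ⟨a', b', c', d', rfl⟩
    refine ⟨0, 0, 2 * (a * c' - c * a'), 2 * (a * d' - d * a' + b * c' - c * b'), ?_⟩
    have h0' : bar 0 = 0 := TensorProduct.tmul_zero _ _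
    simp only [lie_add, add_lie, lie_smul, smul_lie, lie_up_up, lie_up_bar, lie_bar_up,
      lie_bar_bar, lie_self, lie_h_e, lie_e_h, up_smul, bar_smul, h0']
    module

/-- As b̄ is defined by Lie generators, this upper bound is what shows that four vectors span it. -/
lemma borel_le_borelSpan : borel ≤ borelSpan := by
  refine sup_le (LieSubalgebra.lieSpan_le.mpr ?_) (LieSubalgebra.lieSpan_le.mpr ?_)
  · rintro x (rfl | rfl)
    · exact ⟨1, 0, 0, 0, by simp⟩
    · exact ⟨0, 1, 0, 0, by simp⟩
  · rintro x (rfl | rfl)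
    · exact ⟨0, 0, 1, 0, by simp⟩
    · exact ⟨0, 0, 0, 1, by simp⟩

lemma borel_decomp (y : borel) :
    ∃ a b c d : ℂ, y = a • hb + b • hb' + c • eb + d • eb' := by
  obtain ⟨a, b, c, d, hy⟩ := borel_le_borelSpan y.2
  exact ⟨a, b, c, d, Subtype.ext hy⟩

@[elab_as_elim]
lemma borel_induction {P : borel → Prop} (y : borel) (h₁ : P hb) (h₂ : P hb') (h₃ : P eb)
    (h₄ : P eb') (hadd : ∀ a b, P a → P b → P (a + b)) (hsmul : ∀ (c : ℂ) a, P a → P (c • a)) :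
    P y := by
  obtain ⟨a, b, c, d, rfl⟩ := borel_decomp y
  exact hadd _ _ (hadd _ _ (hadd _ _ (hsmul _ _ h₁) (hsmul _ _ h₂)) (hsmul _ _ h₃)) (hsmul _ _ h₄)

instance : Module.Finite ℂ borel := inferInstanceAs (Module.Finite ℂ borel.toSubmodule)

instance : IsNoetherianRing (U borel) := isNoetherianRing_universalEnvelopingAlgebra

@[simp] lemma borelMap_ι (y : borel) :
    borelMap (UniversalEnvelopingAlgebra.ι ℂ y) = UniversalEnvelopingAlgebra.ι ℂ (y : G) :=
  UniversalEnvelopingAlgebra.lift_ι_apply _ _ _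

end Borel

end Takiff

namespace Takiff

open scoped TensorProduct

attribute [local instance] LieRing.ofAssociativeRing

/-! ### Differential operators realising 𝔤 from an action of b̄. -/

section Coordinates

/-- Turns a rewriting rule for two letters into one for the head of a longer right-nested word. -/
lemma mul_mul_of_mul_eq {A : Type*} [Ring A] {a b c : A} (h : a * b = c) (x : A) :
    a * (b * x) = c * x := by
  rw [← mul_assoc, h]

/-- Two commuting copies of the Weyl relations, commuting with an action of `b̄`. -/
structure WeylAction (A : Type*) [Ring A] [Algebra ℂ A] where
  z : A
  w : A
  p : A
  q : A
  ρ : borel →ₗ⁅ℂ⁆ A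
  -- Thus `p` and `q` behave as ∂/∂z and ∂/∂w.
  z_p : z * p = p * z - 1
  w_q : w * q = q * w - 1
  w_z : w * z = z * w
  q_p : q * p = p * q
  w_p : w * p = p * w
  z_q : z * q = q * z
  ρ_z : ∀ y, ρ y * z = z * ρ y
  ρ_w : ∀ y, ρ y * w = w * ρ y
  ρ_p : ∀ y, ρ y * p = p * ρ y
  ρ_q : ∀ y, ρ y * q = q * ρ y

namespace WeylAction

variable {A : Type*} [Ring A] [Algebra ℂ A] (D : WeylAction A)

/-- This and the next five lemmas are oriented as rewriting rules towards the order e, x ⊗ e, h, x ⊗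
h. Sums replace the scalar 2 so that `abel` can compare the results. -/
lemma hb_eb : D.ρ hb * D.ρ eb = D.ρ eb * D.ρ hb + (D.ρ eb + D.ρ eb) := by
  rw [← two_smul ℂ, ← map_smul, ← lie_hb_eb, LieHom.map_lie, LieRing.of_associative_ring_bracket]
  abel

lemma hb_eb' : D.ρ hb * D.ρ eb' = D.ρ eb' * D.ρ hb + (D.ρ eb' + D.ρ eb') := by
  rw [← two_smul ℂ, ← map_smul, ← lie_hb_eb', LieHom.map_lie, LieRing.of_associative_ring_bracket]
  abel

lemma hb'_eb : D.ρ hb' * D.ρ eb = D.ρ eb * D.ρ hb' + (D.ρ eb' + D.ρ eb') := by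
  rw [← two_smul ℂ, ← map_smul, ← lie_hb'_eb, LieHom.map_lie, LieRing.of_associative_ring_bracket]
  abel

lemma hb'_eb' : D.ρ hb' * D.ρ eb' = D.ρ eb' * D.ρ hb' := by
  rw [← sub_eq_zero, ← LieRing.of_associative_ring_bracket, ← LieHom.map_lie, lie_hb'_eb', map_zero]

lemma hb'_hb : D.ρ hb' * D.ρ hb = D.ρ hb * D.ρ hb' := by
  rw [eq_comm, ← sub_eq_zero, ← LieRing.of_associative_ring_bracket, ← LieHom.map_lie, lie_hb_hb',
    map_zero]

lemma eb'_eb : D.ρ eb' * D.ρ eb = D.ρ eb * D.ρ eb' := by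
  rw [eq_comm, ← sub_eq_zero, ← LieRing.of_associative_ring_bracket, ← LieHom.map_lie, lie_eb_eb',
    map_zero]

/-- The operator of `e`. -/
noncomputable def E : A :=
  D.ρ eb - D.p * D.z * D.z - (D.q * D.z * D.w + D.q * D.z * D.w) - D.z * D.ρ hb - D.w * D.ρ hb'
/-- The operator of `x ⊗ e`. -/
noncomputable def E' : A := D.ρ eb' - D.q * D.z * D.z - D.z * D.ρ hb'
/-- The operator of `h`. -/
noncomputable def H : A := D.ρ hb + (D.p * D.z + D.q * D.w) + (D.p * D.z + D.q * D.w)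
/-- The operator of `x ⊗ h`. -/
noncomputable def H' : A := D.ρ hb' + D.q * D.z + D.q * D.z

set_option linter.unusedSimpArgs false in
/-- The action of `𝔤` by first order differential operators induced by an action of `b̄`. -/
noncomputable def rep : G →ₗ⁅ℂ⁆ A := by
  have r₁ := D.z_p
  have r₂ := D.w_q
  have r₃ := D.w_z
  have r₄ := D.q_p
  have r₅ := D.w_p
  have r₆ := D.z_q
  have r₇ := D.ρ_z
  have r₈ := D.ρ_w
  have r₉ := D.ρ_p
  have r₁₀ := D.ρ_q
  have b₁ := D.hb_eb
  have b₂ := D.hb_eb'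
  have b₃ := D.hb'_eb
  have b₄ := D.hb'_eb'
  have b₅ := D.hb'_hb
  have b₆ := D.eb'_eb
  -- Together the rules bring each word into the order p, q, z, w, followed by e, x ⊗ e, h, x ⊗ h.
  -- Every bracket relation becomes an identity of normal forms.
  have t₁ := fun x => mul_mul_of_mul_eq r₁ x
  have t₂ := fun x => mul_mul_of_mul_eq r₂ x
  have t₃ := fun x => mul_mul_of_mul_eq r₃ x
  have t₄ := fun x => mul_mul_of_mul_eq r₄ x
  have t₅ := fun x => mul_mul_of_mul_eq r₅ x
  have t₆ := fun x => mul_mul_of_mul_eq r₆ x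
  have t₇ := fun y x => mul_mul_of_mul_eq (r₇ y) x
  have t₈ := fun y x => mul_mul_of_mul_eq (r₈ y) x
  have t₉ := fun y x => mul_mul_of_mul_eq (r₉ y) x
  have t₁₀ := fun y x => mul_mul_of_mul_eq (r₁₀ y) x
  refine lieHomOfPair (ofBasis D.E D.H D.p) (ofBasis D.E' D.H' D.q)
    (ofBasis_lie _ (ofBasis_e _ _ _) (ofBasis_h _ _ _) (ofBasis_f _ _ _) rfl rfl rfl ?_ ?_ ?_ ?_ ?_
      ?_)
    (ofBasis_lie _ (ofBasis_e _ _ _) (ofBasis_h _ _ _) (ofBasis_f _ _ _) ?_ ?_ ?_ ?_ ?_ ?_ ?_ ?_ ?_)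
    fun a b => ?_
  -- The remaining hypothesis of `lieHomOfPair`: the images of x ⊗ e, x ⊗ h and x ⊗ f commute.
  case refine_16 =>
    have : ∀ x ∈ ({D.E', D.H', D.q} : Set A), ∀ y ∈ ({D.E', D.H', D.q} : Set A),
        x * y = y * x := by
      have h₁ : D.E' * D.H' = D.H' * D.E' := by
        simp only [E', H', mul_add, add_mul, mul_sub, sub_mul, mul_assoc, r₁, r₂, r₃, r₄, r₅, r₆,
          r₇, r₈, r₉, r₁₀, b₁, b₂, b₃, b₄, b₅, b₆, t₁, t₂, t₃, t₄, t₅, t₆, t₇, t₈, t₉, t₁₀, one_mul]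
        abel
      have h₂ : D.E' * D.q = D.q * D.E' := by
        simp only [E', mul_sub, sub_mul, mul_assoc, r₆, r₁₀, t₆, t₁₀]
      have h₃ : D.H' * D.q = D.q * D.H' := by
        simp only [H', mul_add, add_mul, mul_assoc, r₆, r₁₀, t₆, t₁₀]
      rintro x (rfl | rfl | rfl) y (rfl | rfl | rfl) <;> first | rfl | assumption | (symm; assumption)
    induction a using sl2_induction with
    | hadd a c ha hc => rw [map_add, add_mul, mul_add, ha, hc]
    | hsmul c a ha => rw [map_smul, smul_mul_assoc, mul_smul_comm, ha]
    | _ =>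
      induction b using sl2_induction with
      | hadd a c ha hc => rw [map_add, add_mul, mul_add, ha, hc]
      | hsmul c a ha => rw [map_smul, smul_mul_assoc, mul_smul_comm, ha]
      | _ =>
        simp only [ofBasis_e, ofBasis_h, ofBasis_f] <;> exact this _ (by simp) _ (by simp)
  all_goals
    try rw [neg_smul]
    try rw [two_smul]
    simp only [E, E', H, H', mul_add, add_mul, mul_sub, sub_mul, mul_assoc, r₁, r₂, r₃, r₄, r₅, r₆,
      r₇, r₈, r₉, r₁₀, b₁, b₂, b₃, b₄, b₅, b₆, t₁, t₂, t₃, t₄, t₅, t₆, t₇, t₈, t₉, t₁₀, one_mul,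
      mul_one]
    try abel

lemma rep_up_e : D.rep (up e) = D.E := by
  dsimp only [rep]; rw [lieHomOfPair_up, ofBasis_e]
lemma rep_up_h : D.rep (up h) = D.H := by
  dsimp only [rep]; rw [lieHomOfPair_up, ofBasis_h]
lemma rep_up_f : D.rep (up f) = D.p := by
  dsimp only [rep]; rw [lieHomOfPair_up, ofBasis_f]
lemma rep_bar_e : D.rep (bar e) = D.E' := by
  dsimp only [rep]; rw [lieHomOfPair_bar, ofBasis_e]
lemma rep_bar_h : D.rep (bar h) = D.H' := by
  dsimp only [rep]; rw [lieHomOfPair_bar, ofBasis_h]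
lemma rep_bar_f : D.rep (bar f) = D.q := by
  dsimp only [rep]; rw [lieHomOfPair_bar, ofBasis_f]

end WeylAction

section Functions

/-- Multiplication by the first variable, on divided power series with coefficients in `U(b̄)`. -/
noncomputable def mulZ : Module.End ℂ (ℕ → ℕ → U borel) where
  -- The entry `a i j` is the coefficient of zⁱwʲ/(i!j!). At `i = 0` the factor `i` cancels the
  -- truncated index `i - 1`.
  toFun a i j := (i : ℂ) • a (i - 1) j
  map_add' a b := by ext i j; simp
  map_smul' c a := by ext i j; simp [smul_comm c]

/-- Multiplication by the second variable. -/
noncomputable def mulW : Module.End ℂ (ℕ → ℕ → U borel) where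
  toFun a i j := (j : ℂ) • a i (j - 1)
  map_add' a b := by ext i j; simp
  map_smul' c a := by ext i j; simp [smul_comm c]

/-- Differentiation by the first variable. -/
noncomputable def derivZ : Module.End ℂ (ℕ → ℕ → U borel) where
  toFun a i j := a (i + 1) j
  map_add' _ _ := rfl
  map_smul' _ _ := rfl

/-- Differentiation by the second variable. -/
noncomputable def derivW : Module.End ℂ (ℕ → ℕ → U borel) where
  toFun a i j := a i (j + 1)
  map_add' _ _ := rfl
  map_smul' _ _ := rfl

/-- Right multiplication of the coefficients by an element of `U(b̄)`. -/
noncomputable def mulCoeff (u : U borel) : Module.End ℂ (ℕ → ℕ → U borel) where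
  toFun a i j := a i j * u
  map_add' a b := by ext i j; simp [add_mul]
  map_smul' c a := by ext i j; simp

open MulOpposite

/-- The right action of `b̄` on coefficients. -/
noncomputable def coeffAction : borel →ₗ⁅ℂ⁆ (Module.End ℂ (ℕ → ℕ → U borel))ᵐᵒᵖ where
  toFun y := op (mulCoeff (UniversalEnvelopingAlgebra.ι ℂ y))
  map_add' x y := by
    rw [map_add, ← op_add]
    congr 1
    ext a i j
    simp [mulCoeff, mul_add]
  map_smul' c x := by
    rw [map_smul]
    change _ = op (c • mulCoeff _)
    congr 1
    ext a i j
    simp [mulCoeff]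
  map_lie' {x y} := by
    rw [LieHom.map_lie, LieRing.of_associative_ring_bracket, LieRing.of_associative_ring_bracket,
      ← op_mul, ← op_mul, ← op_sub]
    congr 1
    ext a i j
    simp [mulCoeff, mul_sub, mul_assoc]

/-- The differential operators on power series with coefficients in `U(b̄)`, acting from the
right. -/
noncomputable def seriesAction : WeylAction (Module.End ℂ (ℕ → ℕ → U borel))ᵐᵒᵖ where
  -- Passing to the opposite algebra reverses the sign of the commutator of ∂/∂z and z, hence the
  -- minus sign.
  z := op (-mulZ)
  w := op (-mulW)
  p := op derivZ
  q := op derivW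
  ρ := coeffAction
  z_p := congrArg op (LinearMap.ext fun a => funext fun i => funext fun j => by
    rcases i with _ | i <;> simp [mulZ, derivZ]
    module)
  w_q := congrArg op (LinearMap.ext fun a => funext fun i => funext fun j => by
    rcases j with _ | j <;> simp [mulW, derivW]
    module)
  w_z := congrArg op (LinearMap.ext fun a => funext fun i => funext fun j => by
    simp [mulW, mulZ, smul_comm (i : ℂ)])
  q_p := rfl
  w_p := rfl
  z_q := rfl
  ρ_z y := congrArg op (LinearMap.ext fun a => funext fun i => funext fun j => by
    simp [coeffAction, mulCoeff, mulZ])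
  ρ_w y := congrArg op (LinearMap.ext fun a => funext fun i => funext fun j => by
    simp [coeffAction, mulCoeff, mulW])
  ρ_p y := rfl
  ρ_q y := rfl

/-- The right action of `U(𝔤)` on power series. -/
noncomputable def seriesRep : U G →ₐ[ℂ] (Module.End ℂ (ℕ → ℕ → U borel))ᵐᵒᵖ :=
  UniversalEnvelopingAlgebra.lift ℂ seriesAction.rep

end Functions

end Coordinates
end Takiff

namespace Takiff

open scoped TensorProduct

attribute [local instance] LieRing.ofAssociativeRing

/-! ### PBW: U(𝔤) is a free right U(b̄)-module. -/

section Freeness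

open MulOpposite

lemma unop_seriesRep_mul (u v : U G) (a : ℕ → ℕ → U borel) :
    unop (seriesRep (u * v)) a = unop (seriesRep v) (unop (seriesRep u) a) := by
  rw [map_mul, unop_mul]; rfl

lemma seriesRep_ι (x : G) :
    seriesRep (UniversalEnvelopingAlgebra.ι ℂ x) = seriesAction.rep x :=
  UniversalEnvelopingAlgebra.lift_ι_apply _ _ _

/-- On constant terms, `U(b̄)` acts by right multiplication. -/
lemma seriesRep_borelMap (u : U borel) (a : ℕ → ℕ → U borel) :
    unop (seriesRep (borelMap u)) a 0 0 = a 0 0 * u := by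
  induction u using uea_induction generalizing a with
  | halg c =>
    rw [AlgHom.commutes, AlgHom.commutes, ← Algebra.commutes, ← Algebra.smul_def]
    simp [Algebra.algebraMap_eq_smul_one]
  | hι y =>
    rw [borelMap_ι, seriesRep_ι]
    -- Every correction term in `E`, `E'`, `H`, `H'` contains `z` or `w` to the right of `p` and
    -- `q`. In the opposite algebra this means multiplying by a variable after differentiating, so
    -- the constant term of the correction is zero.
    induction y using borel_induction with
    | h₁ =>
      change unop (seriesAction.rep (up h)) a 0 0 = _
      rw [WeylAction.rep_up_h]
      simp [WeylAction.H, seriesAction, coeffAction, mulCoeff, mulZ, mulW]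
    | h₂ =>
      change unop (seriesAction.rep (bar h)) a 0 0 = _
      rw [WeylAction.rep_bar_h]
      simp [WeylAction.H', seriesAction, coeffAction, mulCoeff, mulZ, mulW]
    | h₃ =>
      change unop (seriesAction.rep (up e)) a 0 0 = _
      rw [WeylAction.rep_up_e]
      simp [WeylAction.E, seriesAction, coeffAction, mulCoeff, mulZ, mulW]
    | h₄ =>
      change unop (seriesAction.rep (bar e)) a 0 0 = _
      rw [WeylAction.rep_bar_e]
      simp [WeylAction.E', seriesAction, coeffAction, mulCoeff, mulZ, mulW]
    | hadd x y hx hy =>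
      have : ((x + y : borel) : G) = (x : G) + y := rfl
      rw [this, map_add, map_add, mul_add, unop_add, ← hx, ← hy]
      rfl
    | hsmul c x hx =>
      have : ((c • x : borel) : G) = c • (x : G) := rfl
      rw [this, map_smul, map_smul, mul_smul_comm, unop_smul, ← hx]
      rfl
  | hmul u v hu hv => rw [map_mul, unop_seriesRep_mul, hv, hu, mul_assoc]
  | hadd u v hu hv =>
    rw [map_add, map_add, unop_add, mul_add, ← hu, ← hv]
    rfl

/-- The element `f` of `U(𝔤)`. -/
noncomputable def uf : U G := UniversalEnvelopingAlgebra.ι ℂ (up f)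
/-- The element `x ⊗ f` of `U(𝔤)`. -/
noncomputable def uf' : U G := UniversalEnvelopingAlgebra.ι ℂ (bar f)

lemma seriesRep_uf_pow (k : ℕ) (a : ℕ → ℕ → U borel) (i j : ℕ) :
    unop (seriesRep (uf ^ k)) a i j = a (i + k) j := by
  induction k generalizing a i with
  | zero => simp
  | succ k ih =>
    rw [pow_succ, unop_seriesRep_mul, uf, seriesRep_ι, WeylAction.rep_up_f]
    change unop (seriesRep (uf ^ k)) a (i + 1) j = _
    rw [ih]
    congr 1
    omega

lemma seriesRep_uf'_pow (k : ℕ) (a : ℕ → ℕ → U borel) (i j : ℕ) :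
    unop (seriesRep (uf' ^ k)) a i j = a i (j + k) := by
  induction k generalizing a j with
  | zero => simp
  | succ k ih =>
    rw [pow_succ, unop_seriesRep_mul, uf', seriesRep_ι, WeylAction.rep_bar_f]
    change unop (seriesRep (uf' ^ k)) a i (j + 1) = _
    rw [ih]
    congr 1
    omega

/-- The coordinates of an element of `U(𝔤)` with respect to the basis `fⁱ (x ⊗ f)ʲ` as a right
`U(b̄)`-module. -/
noncomputable def coord (n : ℕ × ℕ) : U G →ₗ[ℂ] U borel where
  toFun u := unop (seriesRep u) (fun i j => if (i, j) = n then 1 else 0) 0 0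
  map_add' u v := by rw [map_add]; rfl
  map_smul' c u := by rw [map_smul]; rfl

lemma coord_mul (n : ℕ × ℕ) (u : U G) (v : U borel) :
    coord n (u * borelMap v) = coord n u * v := by
  change unop (seriesRep _) _ 0 0 = _
  rw [unop_seriesRep_mul, seriesRep_borelMap]
  rfl

/-- With `coord_mul` this makes the `coord n` a dual basis, hence the monomials are independent over
U(b̄). -/
lemma coord_basis (n m : ℕ × ℕ) :
    coord n (uf ^ m.1 * uf' ^ m.2) = if m = n then 1 else 0 := by
  change unop (seriesRep _) _ 0 0 = _
  rw [unop_seriesRep_mul, seriesRep_uf'_pow, seriesRep_uf_pow]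
  simp

lemma exists_mem_nMinus_add_borel (x : G) :
    ∃ (a b : ℂ) (y : borel), x = a • up f + b • bar f + (y : G) := by
  obtain ⟨s, t, rfl⟩ := exists_eq_up_add_bar x
  refine ⟨coordF s, coordF t, coordH s • hb + coordH t • hb' + coordE s • eb + coordE t • eb', ?_⟩
  change _ = _ + (coordH s • up h + coordH t • bar h + coordE s • up e + coordE t • bar e)
  conv_lhs => rw [sl2_decomp s, sl2_decomp t]
  simp only [up_add, bar_add, up_smul, bar_smul]
  abel

/-- The span of the products `fⁱ (x ⊗ f)ʲ b` in `U(𝔤)`. -/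
noncomputable def pbwSpan : Submodule ℂ (U G) :=
  Submodule.span ℂ {u | ∃ (i j : ℕ) (b : U borel), u = uf ^ i * uf' ^ j * borelMap b}

lemma uf'_mul_uf : uf' * uf = uf * uf' := by
  rw [← sub_eq_zero, ← LieRing.of_associative_ring_bracket, uf, uf', ← LieHom.map_lie, lie_bar_up]
  simp [bar]

lemma uf'_mul_uf_pow (i : ℕ) : uf' * uf ^ i = uf ^ i * uf' :=
  (Commute.pow_right (uf'_mul_uf : Commute uf' uf) i)

lemma uf_mul_mem_pbwSpan {u : U G} (hu : u ∈ pbwSpan) : uf * u ∈ pbwSpan := by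
  induction hu using Submodule.span_induction with
  | mem u h =>
    obtain ⟨i, j, b, rfl⟩ := h
    exact Submodule.subset_span ⟨i + 1, j, b, by rw [pow_succ']; simp only [mul_assoc]⟩
  | zero => simp
  | add u v _ _ hu hv => rw [mul_add]; exact add_mem hu hv
  | smul c u _ hu => rw [mul_smul_comm]; exact Submodule.smul_mem _ _ hu

lemma uf'_mul_mem_pbwSpan {u : U G} (hu : u ∈ pbwSpan) : uf' * u ∈ pbwSpan := by
  induction hu using Submodule.span_induction with
  | mem u h =>
    obtain ⟨i, j, b, rfl⟩ := h
    refine Submodule.subset_span ⟨i, j + 1, b, ?_⟩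
    rw [pow_succ', ← mul_assoc, ← mul_assoc, uf'_mul_uf_pow]
    simp only [mul_assoc]
  | zero => simp
  | add u v _ _ hu hv => rw [mul_add]; exact add_mem hu hv
  | smul c u _ hu => rw [mul_smul_comm]; exact Submodule.smul_mem _ _ hu

lemma ι_mul_eq (x y : G) (u : U G) :
    UniversalEnvelopingAlgebra.ι ℂ x * (UniversalEnvelopingAlgebra.ι ℂ y * u) =
      UniversalEnvelopingAlgebra.ι ℂ y * (UniversalEnvelopingAlgebra.ι ℂ x * u) +
        UniversalEnvelopingAlgebra.ι ℂ ⁅x, y⁆ * u := by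
  rw [LieHom.map_lie, LieRing.of_associative_ring_bracket, sub_mul]
  simp only [mul_assoc]
  abel

/-- Moving x past the first letter leaves a commutator term in which another element of 𝔤 multiplies
a shorter monomial. The induction therefore runs over all x at once. -/
lemma ι_mul_basis_mem_pbwSpan (n : ℕ) (x : G) (i j : ℕ) (hn : i + j = n) (b : U borel) :
    UniversalEnvelopingAlgebra.ι ℂ x * (uf ^ i * uf' ^ j * borelMap b) ∈ pbwSpan := by
  induction n generalizing x i j with
  | zero =>
    obtain ⟨rfl, rfl⟩ : i = 0 ∧ j = 0 := by omega
    obtain ⟨s, t, y, rfl⟩ := exists_mem_nMinus_add_borel x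
    have hb : borelMap b ∈ pbwSpan := Submodule.subset_span ⟨0, 0, b, by simp⟩
    simp only [pow_zero, one_mul, map_add, map_smul, add_mul, smul_mul_assoc]
    refine add_mem (add_mem (Submodule.smul_mem _ _ (uf_mul_mem_pbwSpan hb))
      (Submodule.smul_mem _ _ (uf'_mul_mem_pbwSpan hb))) ?_
    rw [← borelMap_ι, ← map_mul]
    exact Submodule.subset_span ⟨0, 0, _, by rw [pow_zero, pow_zero, one_mul, one_mul]⟩
  | succ n ih =>
    rcases i with _ | i
    · rcases j with _ | j
      · omega
      · have h0 : uf ^ 0 * uf' ^ (j + 1) * borelMap b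
            = UniversalEnvelopingAlgebra.ι ℂ (bar f) * (uf ^ 0 * uf' ^ j * borelMap b) := by
          rw [pow_succ']; simp only [mul_assoc, pow_zero, one_mul]; rfl
        rw [h0, ι_mul_eq]
        exact add_mem (uf'_mul_mem_pbwSpan (ih _ _ _ (by omega))) (ih _ _ _ (by omega))
    · have h0 : uf ^ (i + 1) * uf' ^ j * borelMap b
          = UniversalEnvelopingAlgebra.ι ℂ (up f) * (uf ^ i * uf' ^ j * borelMap b) := by
        rw [pow_succ']; simp only [mul_assoc]; rfl
      rw [h0, ι_mul_eq]
      exact add_mem (uf_mul_mem_pbwSpan (ih _ _ _ (by omega))) (ih _ _ _ (by omega))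

lemma mul_mem_pbwSpan (u : U G) {v : U G} (hv : v ∈ pbwSpan) : u * v ∈ pbwSpan := by
  induction u using uea_induction generalizing v with
  | halg c => rw [← Algebra.smul_def]; exact Submodule.smul_mem _ _ hv
  | hι x =>
    induction hv using Submodule.span_induction with
    | mem u h =>
      obtain ⟨i, j, b, rfl⟩ := h
      exact ι_mul_basis_mem_pbwSpan _ x i j rfl b
    | zero => simp
    | add u v _ _ hu hv => rw [mul_add]; exact add_mem hu hv
    | smul c u _ hu => rw [mul_smul_comm]; exact Submodule.smul_mem _ _ hu
  | hmul u w hu hw => rw [mul_assoc]; exact hu (hw hv)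
  | hadd u w hu hw => rw [add_mul]; exact add_mem (hu hv) (hw hv)

lemma pbwSpan_eq_top : pbwSpan = ⊤ := by
  refine eq_top_iff.mpr fun u _ => ?_
  rw [← mul_one u]
  exact mul_mem_pbwSpan u (Submodule.subset_span ⟨0, 0, 1, by simp⟩)

end Freeness

end Takiff

/-! ### Restriction to b̄, and exactness of induction from b̄. -/

namespace Takiff

open scoped TensorProduct

attribute [local instance] LieRing.ofAssociativeRing

/-- Restriction of scalars along `U(b̄) → U(𝔤)`. -/
@[reducible] noncomputable def resModule (X : Type*) [AddCommGroup X] [Module (U G) X] :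
    Module (U borel) X :=
  Module.compHom X borelMap.toRingHom

attribute [local instance 50] resModule

section Restriction

variable {X : Type*} [AddCommGroup X] [Module (U G) X]

lemma res_smul (b : U borel) (x : X) : b • x = borelMap b • x := rfl

instance [Module ℂ X] [IsScalarTower ℂ (U G) X] : IsScalarTower ℂ (U borel) X where
  smul_assoc c b x := by rw [res_smul, map_smul, smul_assoc]; rfl

/-- A `𝔤`-homomorphism, as a homomorphism of modules over `b̄`. -/
noncomputable def resMap {Y : Type*} [AddCommGroup Y] [Module (U G) Y] (φ : X →ₗ[U G] Y) :
    X →ₗ[U borel] Y where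
  toFun := φ
  map_add' := map_add φ
  map_smul' b x := map_smul φ (borelMap b) x

@[simp] lemma resMap_apply {Y : Type*} [AddCommGroup Y] [Module (U G) Y] (φ : X →ₗ[U G] Y)
    (x : X) : resMap φ x = φ x := rfl

end Restriction

section Induction

set_option linter.unusedSectionVars false

variable (V : Type*) [AddCommGroup V] [Module (U borel) V] [Module ℂ V] [IsScalarTower ℂ (U borel) V]

/-- The relations defining the induced module. -/
noncomputable def indRel : Submodule (U G) (U G ⊗[ℂ] V) :=
  Submodule.span (U G) {x | ∃ (b : U borel) (v : V), x = borelMap b ⊗ₜ v - 1 ⊗ₜ (b • v)}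

/-- The induced module `U(𝔤) ⊗_{U(b̄)} V`. -/
abbrev Ind : Type _ := (U G ⊗[ℂ] V) ⧸ indRel V

/-- The map `v ↦ 1 ⊗ v` from a module to its induced module. -/
noncomputable def indMk : V →ₗ[U borel] Ind V where
  toFun v := Submodule.Quotient.mk (1 ⊗ₜ v)
  map_add' v w := by rw [TensorProduct.tmul_add, Submodule.Quotient.mk_add]
  map_smul' b v := by
    rw [RingHom.id_apply, res_smul, ← Submodule.Quotient.mk_smul, eq_comm, Submodule.Quotient.eq]
    exact Submodule.subset_span ⟨b, v, by simp [TensorProduct.smul_tmul']⟩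

variable {V}

lemma mk_tmul (u : U G) (v : V) :
    (Submodule.Quotient.mk (u ⊗ₜ v) : Ind V) = u • indMk V v := by
  change _ = u • Submodule.Quotient.mk _
  rw [← Submodule.Quotient.mk_smul, TensorProduct.smul_tmul', smul_eq_mul, mul_one]

@[elab_as_elim]
lemma ind_induction {P : Ind V → Prop} (w : Ind V) (hmk : ∀ (u : U G) v, P (u • indMk V v))
    (hadd : ∀ w w', P w → P w' → P (w + w')) : P w := by
  obtain ⟨w, rfl⟩ := Submodule.Quotient.mk_surjective _ w
  induction w using TensorProduct.induction_on with
  | zero => simpa using hmk 0 0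
  | tmul u v => rw [mk_tmul]; exact hmk u v
  | add x y hx hy => rw [Submodule.Quotient.mk_add]; exact hadd _ _ hx hy

section Lift

variable {X : Type*} [AddCommGroup X] [Module (U G) X]

lemma ind_hom_ext {φ ψ : Ind V →ₗ[U G] X} (h : ∀ v, φ (indMk V v) = ψ (indMk V v)) : φ = ψ := by
  refine LinearMap.ext fun w => ?_
  induction w using ind_induction with
  | hmk u v => rw [map_smul, map_smul, h]
  | hadd w w' hw hw' => rw [map_add, map_add, hw, hw']

variable [Module ℂ X] [IsScalarTower ℂ (U G) X]

lemma map_complex_smul {A M N : Type*} [Ring A] [Algebra ℂ A] [AddCommGroup M] [Module A M]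
    [Module ℂ M] [IsScalarTower ℂ A M] [AddCommGroup N] [Module A N] [Module ℂ N]
    [IsScalarTower ℂ A N] (φ : M →ₗ[A] N) (c : ℂ) (m : M) : φ (c • m) = c • φ m := by
  rw [← algebraMap_smul A c m, map_smul, algebraMap_smul]

/-- The homomorphism from an induced module given by a homomorphism of `b̄`-modules. -/
noncomputable def indLift (φ : V →ₗ[U borel] X) : Ind V →ₗ[U G] X :=
  haveI : SMulCommClass ℂ (U G) X := IsScalarTower.to_smulCommClass
  (indRel V).liftQ (TensorProduct.AlgebraTensorModule.lift
    (LinearMap.toSpanSingleton (U G) (V →ₗ[ℂ] X)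
      { toFun := φ, map_add' := map_add φ, map_smul' := fun c v => map_complex_smul φ c v })) <| by
    rw [indRel, Submodule.span_le]
    rintro _ ⟨b, v, rfl⟩
    rw [SetLike.mem_coe, LinearMap.mem_ker, map_sub, TensorProduct.AlgebraTensorModule.lift_tmul,
      TensorProduct.AlgebraTensorModule.lift_tmul]
    change borelMap b • φ v - (1 : U G) • φ (b • v) = 0
    rw [map_smul, one_smul, res_smul, sub_self]

@[simp] lemma indLift_mk (φ : V →ₗ[U borel] X) (v : V) : indLift φ (indMk V v) = φ v :=
  one_smul (U G) (φ v)

end Lift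

variable {V' V'' : Type*} [AddCommGroup V'] [Module (U borel) V'] [Module ℂ V']
  [IsScalarTower ℂ (U borel) V'] [AddCommGroup V''] [Module (U borel) V''] [Module ℂ V'']
  [IsScalarTower ℂ (U borel) V'']

/-- Induced modules are functorial. -/
noncomputable def indMap (φ : V →ₗ[U borel] V') : Ind V →ₗ[U G] Ind V' :=
  indLift ((indMk V').comp φ)

@[simp] lemma indMap_mk (φ : V →ₗ[U borel] V') (v : V) :
    indMap φ (indMk V v) = indMk V' (φ v) := indLift_mk _ _

lemma indMap_surjective (φ : V →ₗ[U borel] V') (hφ : Function.Surjective φ) :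
    Function.Surjective (indMap φ) := fun w => by
  induction w using ind_induction with
  | hmk u v =>
    obtain ⟨v, rfl⟩ := hφ v
    exact ⟨u • indMk V v, by simp⟩
  | hadd w w' hw hw' =>
    obtain ⟨a, rfl⟩ := hw
    obtain ⟨b, rfl⟩ := hw'
    exact ⟨a + b, map_add _ _ _⟩

/-- Auxiliary version of `indCoord` before passing to the quotient. -/
noncomputable def tensorCoord (n : ℕ × ℕ) : U G ⊗[ℂ] V →ₗ[ℂ] V :=
  TensorProduct.lift (LinearMap.mk₂ ℂ (fun u v => coord n u • v)
    (fun _ _ _ => by rw [map_add, add_smul])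
    (fun _ _ _ => by rw [map_smul, smul_assoc])
    (fun _ _ _ => smul_add _ _ _)
    (fun c u v => by
      rw [← algebraMap_smul (U borel) c v, smul_smul, ← Algebra.commutes, ← smul_smul,
        algebraMap_smul]))

lemma tensorCoord_tmul (n : ℕ × ℕ) (u : U G) (v : V) :
    tensorCoord n (u ⊗ₜ v) = coord n u • v := by
  simp [tensorCoord]

lemma tensorCoord_eq_zero (n : ℕ × ℕ) {w : U G ⊗[ℂ] V} (hw : w ∈ indRel V) :
    tensorCoord n w = 0 := by
  -- The kernel of `tensorCoord n` is only a complex subspace, so membership in a U(𝔤)-span is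
  -- handled by quantifying over all multiples.
  suffices ∀ u : U G, tensorCoord n (u • w) = 0 by simpa using this 1
  induction hw using Submodule.span_induction with
  | mem w h =>
    intro u
    obtain ⟨b, v, rfl⟩ := h
    rw [smul_sub, TensorProduct.smul_tmul', TensorProduct.smul_tmul', map_sub, tensorCoord_tmul,
      tensorCoord_tmul, smul_eq_mul, smul_eq_mul, coord_mul, mul_one, mul_smul, sub_self]
  | zero => simp
  | add x y _ _ hx hy => intro u; rw [smul_add, map_add, hx, hy, add_zero]
  | smul a x _ hx => intro u; rw [smul_smul]; exact hx _

/-- The coefficients of an element of an induced module, written as a sum of `fⁱ (x ⊗ f)ʲ ⊗ v`. -/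
noncomputable def indCoord (n : ℕ × ℕ) : Ind V →ₗ[ℂ] V :=
  (((indRel V).restrictScalars ℂ).liftQ (tensorCoord n) fun _ hw => tensorCoord_eq_zero n hw) ∘ₗ
    (Submodule.Quotient.restrictScalarsEquiv ℂ (indRel V)).symm.toLinearMap

lemma indCoord_smul_mk (n : ℕ × ℕ) (u : U G) (v : V) :
    indCoord n (u • indMk V v) = coord n u • v := by
  rw [← mk_tmul, ← tensorCoord_tmul]
  rfl

/-- This naturality allows exactness of induction to be checked one coefficient at a time. -/
lemma indCoord_map (n : ℕ × ℕ) (φ : V →ₗ[U borel] V') (w : Ind V) :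
    indCoord n (indMap φ w) = φ (indCoord n w) := by
  induction w using ind_induction with
  | hmk u v => rw [map_smul, indMap_mk, indCoord_smul_mk, indCoord_smul_mk, map_smul]
  | hadd w w' hw hw' => rw [map_add, map_add, map_add, hw, hw', map_add]

lemma exists_finsupp_of_ind (w : Ind V) :
    ∃ x : ℕ × ℕ →₀ V, w = x.sum fun n v => (uf ^ n.1 * uf' ^ n.2) • indMk V v := by
  induction w using ind_induction with
  | hmk u v =>
    have hu : u ∈ pbwSpan := pbwSpan_eq_top ▸ Submodule.mem_top
    induction hu using Submodule.span_induction generalizing v with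
    | mem u h =>
      obtain ⟨i, j, b, rfl⟩ := h
      refine ⟨Finsupp.single (i, j) (b • v), ?_⟩
      rw [Finsupp.sum_single_index (by simp), mul_smul, map_smul, res_smul]
    | zero => exact ⟨0, by simp⟩
    | add u u' _ _ hu hu' =>
      obtain ⟨x, hx⟩ := hu v
      obtain ⟨y, hy⟩ := hu' v
      refine ⟨x + y, ?_⟩
      rw [add_smul, hx, hy, Finsupp.sum_add_index' (by simp) (by simp [smul_add])]
    | smul c u _ hu =>
      obtain ⟨x, hx⟩ := hu (c • v)
      refine ⟨x, ?_⟩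
      rw [← hx, map_complex_smul, ← algebraMap_smul (U G) c (indMk V v), smul_smul,
        ← Algebra.commutes, ← smul_smul, algebraMap_smul, smul_assoc]
  | hadd w w' hw hw' =>
    obtain ⟨x, rfl⟩ := hw
    obtain ⟨y, rfl⟩ := hw'
    refine ⟨x + y, ?_⟩
    rw [Finsupp.sum_add_index' (by simp) (by simp [smul_add])]

/-- Spanning gives some finite expansion; duality of `coord` with the monomials identifies its
coefficients. -/
lemma ind_eq_sum (w : Ind V) : ∃ s : Finset (ℕ × ℕ),
    w = ∑ n ∈ s, (uf ^ n.1 * uf' ^ n.2) • indMk V (indCoord n w) := by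
  obtain ⟨x, hx⟩ := exists_finsupp_of_ind w
  refine ⟨x.support, ?_⟩
  have hn : ∀ n, indCoord n w = x n := fun n => by
    rw [hx, Finsupp.sum, map_sum]
    simp only [indCoord_smul_mk, coord_basis, ite_smul, one_smul, zero_smul]
    simp
  simp only [hn]
  exact hx

lemma indMap_injective (φ : V →ₗ[U borel] V') (hφ : Function.Injective φ) :
    Function.Injective (indMap φ) := by
  rw [injective_iff_map_eq_zero]
  intro w hw
  obtain ⟨s, hs⟩ := ind_eq_sum w
  rw [hs]
  refine Finset.sum_eq_zero fun n _ => ?_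
  have : indCoord n w = 0 := hφ (by rw [← indCoord_map, hw, map_zero, map_zero])
  rw [this, map_zero, smul_zero]

lemma indMap_exact (φ : V →ₗ[U borel] V') (ψ : V' →ₗ[U borel] V'') (h : Function.Exact φ ψ) :
    Function.Exact (indMap φ) (indMap ψ) := by
  intro w
  constructor
  · intro hw
    obtain ⟨s, hs⟩ := ind_eq_sum w
    have : ∀ n, ∃ v, φ v = indCoord n w := fun n =>
      (h _).mp (by rw [← indCoord_map, hw, map_zero])
    choose v hv using this
    refine ⟨∑ n ∈ s, (uf ^ n.1 * uf' ^ n.2) • indMk V (v n), ?_⟩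
    conv_rhs => rw [hs]
    simp [hv]
  · rintro ⟨w, rfl⟩
    have : (indMap ψ) ∘ₗ (indMap φ) = 0 := ind_hom_ext fun v => by
      simp [h.apply_apply_eq_zero]
    exact LinearMap.congr_fun this w

end Induction

end Takiff

namespace Takiff

open scoped TensorProduct

attribute [local instance] LieRing.ofAssociativeRing

/-! ### Artin-Rees property of U(b̄) for finite dimensional submodules. -/

section ArtinRees

set_option linter.unusedSectionVars false

open UniversalEnvelopingAlgebra

/-- A submodule meeting every nonzero submodule. -/
def IsEssential {A X : Type*} [Ring A] [AddCommGroup X] [Module A X] (Y : Submodule A X) : Prop :=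
  ∀ N : Submodule A X, N ⊓ Y = ⊥ → N = ⊥

/-- Permits passing to kernels of normal elements while keeping an essential finite dimensional
submodule. -/
lemma IsEssential.comap {A X : Type*} [Ring A] [AddCommGroup X] [Module A X] {Y : Submodule A X}
    (hY : IsEssential Y) (K : Submodule A X) : IsEssential (Y.comap K.subtype) := fun N hN => by
  have h := hY (N.map K.subtype) (by
    rw [eq_bot_iff]
    rintro _ ⟨⟨x, hx, rfl⟩, hy⟩
    have : x ∈ N ⊓ Y.comap K.subtype := ⟨hx, hy⟩
    rw [hN] at this
    simpa using this)
  exact Submodule.map_injective_of_injective (Submodule.subtype_injective K) (by simpa using h)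

variable {X : Type*} [AddCommGroup X] [Module (U borel) X] [Module ℂ X]
  [IsScalarTower ℂ (U borel) X]

/-- A complex subspace stable under `b̄`, as a submodule. -/
def ofStable (W : Submodule ℂ X) (hW : ∀ y : borel, ∀ w ∈ W, ι ℂ y • w ∈ W) :
    Submodule (U borel) X where
  carrier := W
  zero_mem' := W.zero_mem
  add_mem' := W.add_mem
  smul_mem' u w hw := by
    change u • w ∈ W
    induction u using uea_induction generalizing w with
    | halg c => rw [algebraMap_smul]; exact W.smul_mem c hw
    | hι y => exact hW y w hw
    | hmul u v hu hv => rw [mul_smul]; exact hu _ (hv _ hw)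
    | hadd u v hu hv => rw [add_smul]; exact W.add_mem (hu _ hw) (hv _ hw)

/-- The action of an element of `U(b̄)` as a complex linear map. -/
noncomputable def act (X : Type*) [AddCommGroup X] [Module (U borel) X] [Module ℂ X]
    [IsScalarTower ℂ (U borel) X] : U borel →ₐ[ℂ] Module.End ℂ X :=
  haveI : SMulCommClass (U borel) ℂ X := IsScalarTower.to_smulCommClass'
  Algebra.lsmul ℂ ℂ X

@[simp] lemma act_apply (u : U borel) (x : X) : act X u x = u • x := rfl

/-- `s` commutes on `X` with each element of `b̄` up to adding a scalar to the latter. -/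
def IsNormalOn (s : U borel) (X : Type*) [AddCommGroup X] [Module (U borel) X] [Module ℂ X]
    [IsScalarTower ℂ (U borel) X] : Prop :=
  ∀ y : borel, ∃ c : ℂ, ∀ x : X, s • ι ℂ y • x = ι ℂ y • s • x + c • s • x

lemma smul_comm_complex (u : U borel) (c : ℂ) (x : X) : u • c • x = c • u • x :=
  map_smul (act X u) c x

lemma IsNormalOn.pow {s : U borel} (hs : IsNormalOn s X) (k : ℕ) : IsNormalOn (s ^ k) X := by
  intro y
  induction k with
  | zero => exact ⟨0, by simp⟩
  | succ k ih =>
    obtain ⟨c, hc⟩ := hs y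
    obtain ⟨d, hd⟩ := ih
    refine ⟨c + d, fun x => ?_⟩
    rw [pow_succ', mul_smul, hd, smul_add, hc, mul_smul, smul_comm_complex, add_smul, add_assoc]

/-- The kernel of a normal element. -/
noncomputable def IsNormalOn.ker {s : U borel} (hs : IsNormalOn s X) : Submodule (U borel) X :=
  ofStable (LinearMap.ker (act X s)) fun y w hw => by
    obtain ⟨c, hc⟩ := hs y
    have hw : s • w = 0 := hw
    change s • ι ℂ y • w = 0
    rw [hc, hw, smul_zero, smul_zero, add_zero]

/-- The image of a normal element. -/
noncomputable def IsNormalOn.range {s : U borel} (hs : IsNormalOn s X) : Submodule (U borel) X :=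
  ofStable (LinearMap.range (act X s)) fun y w hw => by
    obtain ⟨c, hc⟩ := hs y
    obtain ⟨x, rfl⟩ := hw
    refine ⟨ι ℂ y • x - c • x, ?_⟩
    change s • (ι ℂ y • x - c • x) = ι ℂ y • s • x
    rw [smul_sub, hc, smul_comm_complex, add_sub_cancel_right]

lemma IsNormalOn.mem_ker {s : U borel} (hs : IsNormalOn s X) {x : X} : x ∈ hs.ker ↔ s • x = 0 :=
  Iff.rfl

/-- A normal element that is nilpotent on an essential submodule is nilpotent. -/
lemma IsNormalOn.exists_pow_smul_eq_zero [IsNoetherian (U borel) X] {s : U borel}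
    (hs : IsNormalOn s X) {Y : Submodule (U borel) X} (hY : IsEssential Y) {m : ℕ}
    (hm : ∀ y ∈ Y, s ^ m • y = 0) : ∃ k, ∀ x : X, s ^ k • x = 0 := by
  let K : ℕ →o Submodule (U borel) X := ⟨fun k => (hs.pow k).ker, fun a b hab x hx => by
    rw [IsNormalOn.mem_ker] at hx ⊢
    rw [← Nat.sub_add_cancel hab, pow_add, mul_smul, hx, smul_zero]⟩
  -- Let the kernels of powers stabilise at n. If sⁿz lies in Y then s^{m+n}z = 0, so already sⁿz =
  -- 0. The image of sⁿ thus meets the essential submodule Y trivially and is zero.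
  obtain ⟨n, hn⟩ := monotone_stabilizes_iff_noetherian.mpr ‹_› K
  have hK : ∀ j, n ≤ j → ∀ x : X, s ^ j • x = 0 → s ^ n • x = 0 := fun j hj x hx => by
    have : x ∈ K j := hx
    rw [← hn j hj] at this
    exact this
  refine ⟨n, fun x => ?_⟩
  have := hY (hs.pow n).range (by
    rw [eq_bot_iff]
    rintro _ ⟨⟨z, rfl⟩, hy⟩
    change s ^ n • z = 0
    refine hK (m + n) (by omega) z ?_
    rw [pow_add, mul_smul]
    exact hm _ hy)
  have hx : s ^ n • x ∈ (hs.pow n).range := ⟨x, rfl⟩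
  rw [this] at hx
  exact hx

/-- The kernel of ST is an extension of a subspace of ker S by ker T, so finite dimensionality of
kernels passes to products. -/
lemma finiteDimensional_of_list_prod_eq_zero {V : Type*} [AddCommGroup V] [Module ℂ V]
    (l : List (Module.End ℂ V)) (hl : ∀ T ∈ l, FiniteDimensional ℂ (LinearMap.ker T))
    (h : l.prod = 0) : FiniteDimensional ℂ V := by
  have key : FiniteDimensional ℂ (LinearMap.ker l.prod) := by
    clear h
    induction l with
    | nil =>
      rw [List.prod_nil, show LinearMap.ker (1 : Module.End ℂ V) = ⊥ from LinearMap.ker_id]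
      infer_instance
    | cons T l ih =>
      have h₁ := hl T (by simp)
      have h₂ := ih fun S hS => hl S (by simp [hS])
      rw [List.prod_cons]
      refine Module.Finite.iff_fg.mpr (Submodule.fg_of_fg_map_of_fg_inf_ker l.prod ?_ ?_)
      · have : (LinearMap.ker (T * l.prod)).map l.prod ≤ LinearMap.ker T := by
          rintro _ ⟨x, hx, rfl⟩
          exact hx
        have := Submodule.finiteDimensional_of_le this
        exact Module.Finite.iff_fg.mp this
      · have := Submodule.finiteDimensional_of_le
          (inf_le_right : LinearMap.ker (T * l.prod) ⊓ LinearMap.ker l.prod ≤ _)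
        exact Module.Finite.iff_fg.mp this
  rw [h, LinearMap.ker_zero] at key
  exact Module.Finite.of_surjective (⊤ : Submodule ℂ V).subtype fun x => ⟨⟨x, trivial⟩, rfl⟩

/-- If a product of elements is normal and nilpotent on an essential submodule, and each factor has
finite dimensional kernel, then the whole module is finite dimensional. -/
lemma finiteDimensional_of_normal_prod [IsNoetherian (U borel) X] (l : List (U borel))
    (hs : IsNormalOn l.prod X) {Y : Submodule (U borel) X} (hY : IsEssential Y) {m : ℕ}
    (hm : ∀ y ∈ Y, l.prod ^ m • y = 0)
    (hl : ∀ t ∈ l, FiniteDimensional ℂ (LinearMap.ker (act X t))) : FiniteDimensional ℂ X := by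
  obtain ⟨k, hk⟩ := hs.exists_pow_smul_eq_zero hY hm
  refine finiteDimensional_of_list_prod_eq_zero (((List.replicate k l).flatten).map (act X)) ?_ ?_
  · intro T hT
    obtain ⟨t, ht, rfl⟩ := List.mem_map.mp hT
    obtain ⟨l', hl', ht⟩ := List.mem_flatten.mp ht
    rw [List.eq_of_mem_replicate hl'] at ht
    exact hl t ht
  · rw [← map_list_prod, List.prod_flatten, List.map_replicate, List.prod_replicate]
    exact LinearMap.ext hk

/-- An element shifting the eigenvalues of another operator is nilpotent. -/
lemma isNilpotent_of_commutator {V : Type*} [AddCommGroup V] [Module ℂ V] [FiniteDimensional ℂ V]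
    (S T : Module.End ℂ V) (h : S * T - T * S = (2 : ℂ) • T) : ∃ m, T ^ m = 0 := by
  by_contra! hT
  -- If no power of T vanished, the Tᵏ would be eigenvectors of ad S for the infinitely many
  -- eigenvalues 2k.
  let ad : Module.End ℂ (Module.End ℂ V) := LinearMap.mulLeft ℂ S - LinearMap.mulRight ℂ S
  have had : ∀ k : ℕ, ad (T ^ k) = (2 * k : ℂ) • T ^ k := by
    intro k
    induction k with
    | zero => simp [ad]
    | succ k ih =>
      have ih' : S * T ^ k - T ^ k * S = (2 * k : ℂ) • T ^ k := ih
      change S * T ^ (k + 1) - T ^ (k + 1) * S = _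
      have : S * T ^ (k + 1) - T ^ (k + 1) * S
          = (S * T ^ k - T ^ k * S) * T + T ^ k * (S * T - T * S) := by
        rw [pow_succ]; noncomm_ring
      rw [this, ih', h, smul_mul_assoc, mul_smul_comm, ← pow_succ]
      push_cast
      module
  have hev : ∀ k : ℕ, (2 * k : ℂ) ∈ {μ | ad.HasEigenvalue μ} := fun k =>
    Module.End.hasEigenvalue_of_hasEigenvector
      (Module.End.hasEigenvector_iff.mpr ⟨Module.End.mem_eigenspace_iff.mpr (had k), hT k⟩)
  refine Set.infinite_of_injective_forall_mem (f := fun k : ℕ => (2 * k : ℂ)) ?_ hev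
    ad.finite_hasEigenvalue
  intro a b hab
  simpa using hab

lemma ι_commutator (x y : borel) (v : X) :
    ι ℂ x • ι ℂ y • v = ι ℂ y • ι ℂ x • v + ι ℂ ⁅x, y⁆ • v := by
  rw [LieHom.map_lie, LieRing.of_associative_ring_bracket, sub_smul, mul_smul, mul_smul]
  abel

lemma exists_pow_smul_eq_zero_of_lie {t : borel} (ht : ⁅hb, t⁆ = (2 : ℂ) • t)
    (Y : Submodule (U borel) X) [FiniteDimensional ℂ Y] : ∃ m, ∀ y ∈ Y, ι ℂ t ^ m • y = 0 := by
  obtain ⟨m, hm⟩ := isNilpotent_of_commutator (act Y (ι ℂ hb)) (act Y (ι ℂ t)) (by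
    rw [← map_mul (act Y), ← map_mul (act Y), ← map_sub (act Y),
      ← LieRing.of_associative_ring_bracket, ← LieHom.map_lie, ht, map_smul, map_smul])
  refine ⟨m, fun y hy => ?_⟩
  rw [← map_pow] at hm
  exact congrArg Subtype.val (LinearMap.congr_fun hm ⟨y, hy⟩)

/-- A noetherian module with an essential finite dimensional submodule is finite dimensional, if
this holds for the kernels of `t - a` for a central `t`. -/
lemma finiteDimensional_of_central [IsNoetherian (U borel) X] {Y : Submodule (U borel) X}
    (hY : IsEssential Y) [FiniteDimensional ℂ Y] (t : U borel)
    (ht : ∀ (y : borel) (x : X), t • ι ℂ y • x = ι ℂ y • t • x)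
    (hker : ∀ a : ℂ, FiniteDimensional ℂ (LinearMap.ker (act X (t - algebraMap ℂ _ a)))) :
    FiniteDimensional ℂ X := by
  let T := act Y t
  -- By Cayley-Hamilton the product over the roots, with multiplicity, kills Y, so the exponent 1
  -- suffices.
  let l : List (U borel) := T.charpoly.roots.toList.map fun a => t - algebraMap ℂ _ a
  have hl : ∀ (y : borel) (x : X), l.prod • ι ℂ y • x = ι ℂ y • l.prod • x := by
    suffices ∀ m : List ℂ, ∀ (y : borel) (x : X),
        (m.map fun a => t - algebraMap ℂ (U borel) a).prod • ι ℂ y • x =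
          ι ℂ y • (m.map fun a => t - algebraMap ℂ (U borel) a).prod • x from this _
    intro m y x
    induction m with
    | nil => simp
    | cons a m ih =>
      rw [List.map_cons, List.prod_cons, mul_smul, ih, sub_smul, ht, mul_smul, sub_smul,
        algebraMap_smul, algebraMap_smul, smul_sub, smul_comm_complex]
  refine finiteDimensional_of_normal_prod l (fun y => ⟨0, fun x => ?_⟩) hY (m := 1) ?_ ?_
  · rw [hl, zero_smul, add_zero]
  · intro y hy
    have h₁ : Polynomial.aeval T T.charpoly = 0 := LinearMap.aeval_self_charpoly T
    have h₂ : T.charpoly = (T.charpoly.roots.map fun a => Polynomial.X - Polynomial.C a).prod :=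
      (IsAlgClosed.splits T.charpoly).eq_prod_roots_of_monic T.charpoly_monic
    have h₃ : act Y l.prod = 0 := by
      rw [← h₁]
      conv_rhs => rw [h₂]
      rw [← Multiset.coe_toList T.charpoly.roots, Multiset.map_coe, Multiset.prod_coe,
        map_list_prod, map_list_prod, List.map_map, List.map_map]
      congr 1
      refine List.map_congr_left fun a _ => ?_
      simp [T]
    rw [pow_one]
    exact congrArg Subtype.val (LinearMap.congr_fun h₃ ⟨y, hy⟩)
  · intro s hs
    obtain ⟨a, _, rfl⟩ := List.mem_map.mp hs
    exact hker a

/-- The complex span of a finite generating set is already stable under b̄. -/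
lemma finiteDimensional_of_scalar [Module.Finite (U borel) X]
    (h : ∀ y : borel, ∃ c : ℂ, ∀ x : X, ι ℂ y • x = c • x) : FiniteDimensional ℂ X := by
  obtain ⟨s, hs⟩ := Module.Finite.fg_top (R := U borel) (M := X)
  refine ⟨⟨s, ?_⟩⟩
  have hW : ∀ y : borel, ∀ w ∈ Submodule.span ℂ (s : Set X),
      ι ℂ y • w ∈ Submodule.span ℂ (s : Set X) := fun y w hw => by
    obtain ⟨c, hc⟩ := h y
    rw [hc]
    exact Submodule.smul_mem _ _ hw
  have : Submodule.span (U borel) (s : Set X) ≤ ofStable _ hW :=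
    Submodule.span_le.mpr Submodule.subset_span
  rw [hs] at this
  exact eq_top_iff.mpr fun x _ => this (Submodule.mem_top (x := x))

/-- The four bracket lemmas drive a descent: x ⊗ e spans an ideal of b̄, e spans one modulo x ⊗ e,
and b̄ modulo both is abelian. -/
lemma lie_hb (y : borel) : ∃ c d : ℂ, ⁅hb, y⁆ = c • eb + d • eb' := by
  obtain ⟨a, b, c, d, rfl⟩ := borel_decomp y
  refine ⟨2 * c, 2 * d, ?_⟩
  simp only [lie_add, lie_smul, lie_self, lie_hb_hb', lie_hb_eb, lie_hb_eb']
  module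

lemma lie_hb' (y : borel) : ∃ c : ℂ, ⁅hb', y⁆ = c • eb' := by
  obtain ⟨a, b, c, d, rfl⟩ := borel_decomp y
  refine ⟨2 * c, ?_⟩
  simp only [lie_add, lie_smul, lie_self, ← lie_skew hb' hb, lie_hb_hb', lie_hb'_eb, lie_hb'_eb']
  module

lemma lie_eb (y : borel) : ∃ c d : ℂ, ⁅eb, y⁆ = c • eb + d • eb' := by
  obtain ⟨a, b, c, d, rfl⟩ := borel_decomp y
  refine ⟨-(2 * a), -(2 * b), ?_⟩
  simp only [lie_add, lie_smul, lie_self, ← lie_skew eb hb, ← lie_skew eb hb', lie_hb_eb,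
    lie_hb'_eb, lie_eb_eb']
  module

lemma lie_eb' (y : borel) : ∃ c : ℂ, ⁅eb', y⁆ = c • eb' := by
  obtain ⟨a, b, c, d, rfl⟩ := borel_decomp y
  refine ⟨-(2 * a), ?_⟩
  simp only [lie_add, lie_smul, lie_self, ← lie_skew eb' hb, ← lie_skew eb' hb', ← lie_skew eb' eb,
    lie_hb_eb', lie_hb'_eb', lie_eb_eb']
  module

lemma IsNormalOn.finiteDimensional_ker {s : U borel} (hs : IsNormalOn s X)
    (h : FiniteDimensional ℂ hs.ker) : FiniteDimensional ℂ (LinearMap.ker (act X s)) :=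
  FiniteDimensional.of_injective
    ({ toFun := fun x => ⟨x.1, x.2⟩, map_add' := fun _ _ => rfl, map_smul' := fun _ _ => rfl } :
      LinearMap.ker (act X s) →ₗ[ℂ] hs.ker) fun _ _ hab =>
    Subtype.ext (congrArg (fun z : hs.ker => (z : X)) hab)

lemma finiteDimensional_comap (K Y : Submodule (U borel) X) [FiniteDimensional ℂ Y] :
    FiniteDimensional ℂ (Y.comap K.subtype) :=
  FiniteDimensional.of_injective
    ({ toFun := fun x => ⟨x.1.1, x.2⟩, map_add' := fun _ _ => rfl, map_smul' := fun _ _ => rfl } :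
      Y.comap K.subtype →ₗ[ℂ] Y) fun _ _ hab =>
    Subtype.ext (Subtype.ext (congrArg (fun z : Y => (z : X)) hab))

lemma isNormalOn_of_central {t : U borel}
    (ht : ∀ (y : borel) (x : X), t • ι ℂ y • x = ι ℂ y • t • x) (a : ℂ) :
    IsNormalOn (t - algebraMap ℂ _ a) X := fun y => ⟨0, fun x => by
  rw [sub_smul, sub_smul, ht, algebraMap_smul, algebraMap_smul, smul_sub, smul_comm_complex,
    zero_smul, add_zero]⟩

/-- Bottom of the descent: h acts centrally, and on the kernel of h - b all of b̄ acts by scalars.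
-/
lemma finiteDimensional_of_isEssential_of_scalar [IsNoetherian (U borel) X]
    {Y : Submodule (U borel) X} (hY : IsEssential Y) [FiniteDimensional ℂ Y]
    (h₁ : ∀ x : X, ι ℂ eb • x = 0) (h₂ : ∀ x : X, ι ℂ eb' • x = 0) (a : ℂ)
    (h₃ : ∀ x : X, ι ℂ hb' • x = a • x) : FiniteDimensional ℂ X := by
  have ht : ∀ (y : borel) (x : X), ι ℂ hb • ι ℂ y • x = ι ℂ y • ι ℂ hb • x := fun y x => by
    obtain ⟨c, d, hcd⟩ := lie_hb y
    rw [ι_commutator, hcd, map_add, map_smul, map_smul, add_smul, smul_assoc, smul_assoc, h₁, h₂,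
      smul_zero, smul_zero, add_zero, add_zero]
  refine finiteDimensional_of_central hY (ι ℂ hb) ht fun b =>
    (isNormalOn_of_central ht b).finiteDimensional_ker (finiteDimensional_of_scalar fun y => ?_)
  obtain ⟨a₁, a₂, a₃, a₄, rfl⟩ := borel_decomp y
  refine ⟨a₁ * b + a₂ * a, fun x => Subtype.ext ?_⟩
  have hx : ι ℂ hb • (x : X) = b • (x : X) := by
    have : (ι ℂ hb - algebraMap ℂ _ b) • (x : X) = 0 := x.2
    rwa [sub_smul, algebraMap_smul, sub_eq_zero] at this
  change ι ℂ (a₁ • hb + a₂ • hb' + a₃ • eb + a₄ • eb') • (x : X) = _ • (x : X)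
  simp only [map_add, map_smul, add_smul, smul_assoc, h₁, h₂, h₃, hx, smul_zero]
  module

/-- Here x ⊗ h acts centrally, and it acts by a scalar on each kernel of x ⊗ h - b. -/
lemma finiteDimensional_of_isEssential_of_nPlus [IsNoetherian (U borel) X]
    {Y : Submodule (U borel) X} (hY : IsEssential Y) [FiniteDimensional ℂ Y]
    (h₁ : ∀ x : X, ι ℂ eb • x = 0) (h₂ : ∀ x : X, ι ℂ eb' • x = 0) : FiniteDimensional ℂ X := by
  have ht : ∀ (y : borel) (x : X), ι ℂ hb' • ι ℂ y • x = ι ℂ y • ι ℂ hb' • x := fun y x => by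
    obtain ⟨c, hc⟩ := lie_hb' y
    rw [ι_commutator, hc, map_smul, smul_assoc, h₂, smul_zero, add_zero]
  refine finiteDimensional_of_central hY (ι ℂ hb') ht fun b => ?_
  have hn := isNormalOn_of_central ht b
  refine hn.finiteDimensional_ker ?_
  have := finiteDimensional_comap hn.ker Y
  refine finiteDimensional_of_isEssential_of_scalar (hY.comap hn.ker)
    (fun x => Subtype.ext (h₁ x)) (fun x => Subtype.ext (h₂ x)) b fun x => Subtype.ext ?_
  have : (ι ℂ hb' - algebraMap ℂ _ b) • (x : X) = 0 := x.2
  rwa [sub_smul, algebraMap_smul, sub_eq_zero] at this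

/-- Once x ⊗ e acts as zero, e is normal. It is nilpotent on Y because [h, e] = 2e, and its kernel
is covered by the previous case. -/
lemma finiteDimensional_of_isEssential_of_eb' [IsNoetherian (U borel) X]
    {Y : Submodule (U borel) X} (hY : IsEssential Y) [FiniteDimensional ℂ Y]
    (h₂ : ∀ x : X, ι ℂ eb' • x = 0) : FiniteDimensional ℂ X := by
  have hn : IsNormalOn (ι ℂ eb) X := fun y => by
    obtain ⟨c, d, hcd⟩ := lie_eb y
    refine ⟨c, fun x => ?_⟩
    rw [ι_commutator, hcd, map_add, map_smul, map_smul, add_smul, smul_assoc, smul_assoc, h₂,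
      smul_zero, add_zero]
  obtain ⟨m, hm⟩ := exists_pow_smul_eq_zero_of_lie lie_hb_eb Y
  refine finiteDimensional_of_normal_prod [ι ℂ eb] (by simpa using hn) hY (m := m)
    (by simpa using hm) ?_
  intro t ht
  obtain rfl := List.mem_singleton.mp ht
  have := finiteDimensional_comap hn.ker Y
  exact hn.finiteDimensional_ker (finiteDimensional_of_isEssential_of_nPlus (hY.comap hn.ker)
    (fun x => Subtype.ext x.2) fun x => Subtype.ext (h₂ x))

/-- Finitely generated essential extensions of finite dimensional `b̄`-modules are finite
dimensional. -/
theorem finiteDimensional_of_isEssential [IsNoetherian (U borel) X]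
    {Y : Submodule (U borel) X} (hY : IsEssential Y) [FiniteDimensional ℂ Y] :
    FiniteDimensional ℂ X := by
  -- Top of the descent: x ⊗ e is normal on every b̄-module and nilpotent on Y.
  have hn : IsNormalOn (ι ℂ eb') X := fun y => by
    obtain ⟨c, hc⟩ := lie_eb' y
    refine ⟨c, fun x => ?_⟩
    rw [ι_commutator, hc, map_smul, smul_assoc]
  obtain ⟨m, hm⟩ := exists_pow_smul_eq_zero_of_lie lie_hb_eb' Y
  refine finiteDimensional_of_normal_prod [ι ℂ eb'] (by simpa using hn) hY (m := m)
    (by simpa using hm) ?_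
  intro t ht
  obtain rfl := List.mem_singleton.mp ht
  have := finiteDimensional_comap hn.ker Y
  exact hn.finiteDimensional_ker (finiteDimensional_of_isEssential_of_eb' (hY.comap hn.ker)
    fun x => Subtype.ext x.2)

/-- The Artin-Rees property: a finite dimensional submodule of a finitely generated `b̄`-module
embeds in a finite dimensional quotient. -/
theorem exists_finiteDimensional_quotient [IsNoetherian (U borel) X] (Y : Submodule (U borel) X)
    [FiniteDimensional ℂ Y] :
    ∃ N : Submodule (U borel) X, N ⊓ Y = ⊥ ∧ FiniteDimensional ℂ (X ⧸ N) := by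
  -- For N maximal among the submodules meeting Y trivially, the image of Y in X/N is essential.
  obtain ⟨N, hN, hmax⟩ := set_has_maximal_iff_noetherian.mpr ‹IsNoetherian (U borel) X›
    {N | N ⊓ Y = ⊥} ⟨⊥, bot_inf_eq _⟩
  refine ⟨N, hN, ?_⟩
  have : FiniteDimensional ℂ (Y.map N.mkQ) :=
    Module.Finite.of_surjective
      ({ toFun := fun y => ⟨N.mkQ y, Submodule.mem_map_of_mem y.2⟩
         map_add' := fun _ _ => rfl
         map_smul' := fun _ _ => rfl } : Y →ₗ[ℂ] Y.map N.mkQ) (by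
        rintro ⟨_, y, hy, rfl⟩
        exact ⟨⟨y, hy⟩, rfl⟩)
  refine finiteDimensional_of_isEssential (Y := Y.map N.mkQ) fun M hM => ?_
  have hle : N ≤ M.comap N.mkQ := fun x hx => by
    have : N.mkQ x = 0 := (Submodule.Quotient.mk_eq_zero N).mpr hx
    rw [Submodule.mem_comap, this]
    exact M.zero_mem
  have hmem : M.comap N.mkQ ⊓ Y = ⊥ := by
    rw [eq_bot_iff]
    rintro x ⟨hx, hy⟩
    have : N.mkQ x ∈ M ⊓ Y.map N.mkQ := ⟨hx, Submodule.mem_map_of_mem hy⟩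
    rw [hM] at this
    have : x ∈ N ⊓ Y := ⟨(Submodule.Quotient.mk_eq_zero N).mp this, hy⟩
    rwa [hN] at this
  have heq : N = M.comap N.mkQ := by
    by_contra h
    exact hmax _ hmem (lt_of_le_of_ne hle h)
  rw [eq_bot_iff]
  intro x hx
  obtain ⟨x, rfl⟩ := N.mkQ_surjective x
  have : x ∈ M.comap N.mkQ := hx
  rw [← heq] at this
  exact (Submodule.Quotient.mk_eq_zero N).mpr this

end ArtinRees
end Takiff

namespace Takiff

open scoped TensorProduct

attribute [local instance] LieRing.ofAssociativeRing
attribute [local instance 50] resModule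

/-! ### Locally finite parts and injectivity over b̄. -/

section LocallyFinite

open UniversalEnvelopingAlgebra

lemma IsLocallyFinite.finiteDimensional {A M : Type*} [Ring A] [Algebra ℂ A] [AddCommGroup M]
    [Module A M] [Module ℂ M] [IsScalarTower ℂ A M] [Module.Finite A M]
    (h : IsLocallyFinite A M) : FiniteDimensional ℂ M := by
  classical
  obtain ⟨s, hs⟩ := Module.Finite.fg_top (R := A) (M := M)
  have key : ∀ s : Finset M, ((Submodule.span A (s : Set M)).restrictScalars ℂ).FG := by
    intro s
    induction s using Finset.induction_on with
    | empty => simpa using Submodule.fg_bot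
    | insert x s _ ih =>
      rw [Finset.coe_insert, Submodule.span_insert, Submodule.restrictScalars_sup]
      exact (Module.Finite.iff_fg.mp (h x)).sup ih
  refine ⟨?_⟩
  have := key s
  rwa [hs, Submodule.restrictScalars_top] at this

lemma isLocallyFinite_of_finiteDimensional {A M : Type*} [Ring A] [Algebra ℂ A] [AddCommGroup M]
    [Module A M] [Module ℂ M] [IsScalarTower ℂ A M] [FiniteDimensional ℂ M] :
    IsLocallyFinite A M := fun m =>
  inferInstanceAs (FiniteDimensional ℂ ((Submodule.span A {m}).restrictScalars ℂ))

lemma isLocallyFinite_of_forall_mem {A M : Type*} [Ring A] [Algebra ℂ A] [AddCommGroup M]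
    [Module A M] [Module ℂ M] [IsScalarTower ℂ A M]
    (h : ∀ m : M, ∃ W : Submodule A M, FiniteDimensional ℂ W ∧ m ∈ W) : IsLocallyFinite A M := by
  intro m
  obtain ⟨W, hW, hm⟩ := h m
  have : FiniteDimensional ℂ (W.restrictScalars ℂ) := hW
  exact Submodule.finiteDimensional_of_le (S₂ := W.restrictScalars ℂ)
    (S₁ := (Submodule.span A {m}).restrictScalars ℂ)
    ((Submodule.span_singleton_le_iff_mem m W).mpr hm)

variable (X : Type*) [AddCommGroup X] [Module (U G) X] [Module ℂ X] [IsScalarTower ℂ (U G) X]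

/-- The action of `𝔤` on a module as a bilinear map. -/
noncomputable def gAction : G →ₗ[ℂ] X →ₗ[ℂ] X :=
  haveI : SMulCommClass (U G) ℂ X := IsScalarTower.to_smulCommClass'
  (Algebra.lsmul ℂ ℂ X : U G →ₐ[ℂ] Module.End ℂ X).toLinearMap ∘ₗ (ι ℂ : G →ₗ⁅ℂ⁆ U G).toLinearMap

variable {X}

/-- The subspace `𝔤 W`, for a `b̄`-submodule `W`. -/
noncomputable def gSpan (W : Submodule (U borel) X) : Submodule (U borel) X :=
  ofStable (Submodule.map₂ (gAction X) ⊤ (W.restrictScalars ℂ)) fun y w hw => by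
    revert w
    change Submodule.map₂ (gAction X) ⊤ (W.restrictScalars ℂ) ≤
      (Submodule.map₂ (gAction X) ⊤ (W.restrictScalars ℂ)).comap (act X (ι ℂ y))
    rw [Submodule.map₂_le]
    intro g _ w hw
    -- The Leibniz rule y(gw) = g(yw) + [y,g]w is why 𝔤W is b̄-stable, and hence why `gamma` is a
    -- 𝔤-submodule.
    have h₁ : act X (ι ℂ y) (gAction X g w) =
        gAction X g (ι ℂ y • w) + gAction X ⁅(y : G), g⁆ w := by
      change borelMap (ι ℂ y) • ι ℂ g • w = ι ℂ g • borelMap (ι ℂ y) • w + ι ℂ ⁅(y : G), g⁆ • w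
      rw [borelMap_ι, LieHom.map_lie, LieRing.of_associative_ring_bracket, sub_smul, mul_smul,
        mul_smul]
      abel
    rw [Submodule.mem_comap, h₁]
    exact add_mem (Submodule.apply_mem_map₂ _ trivial (W.smul_mem _ hw))
      (Submodule.apply_mem_map₂ _ trivial hw)

lemma finiteDimensional_gSpan (W : Submodule (U borel) X) [hW : FiniteDimensional ℂ W] :
    FiniteDimensional ℂ (gSpan W) := by
  have h₁ : (W.restrictScalars ℂ).FG := Module.Finite.iff_fg.mp hW
  have h₂ : (⊤ : Submodule ℂ G).FG := Module.Finite.fg_top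
  exact Module.Finite.iff_fg.mpr (h₂.map₂ (gAction X) h₁)

variable (X)

/-- The largest submodule on which `U(b̄)` acts locally finitely. -/
noncomputable def gamma : Submodule (U G) X where
  carrier := {x | ∃ W : Submodule (U borel) X, FiniteDimensional ℂ W ∧ x ∈ W}
  zero_mem' := ⟨⊥, inferInstanceAs (FiniteDimensional ℂ (⊥ : Submodule ℂ X)), zero_mem _⟩
  add_mem' := by
    rintro x y ⟨W, hW, hx⟩ ⟨W', hW', hy⟩
    refine ⟨W ⊔ W', ?_, add_mem (Submodule.mem_sup_left hx) (Submodule.mem_sup_right hy)⟩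
    have h₁ : (W.restrictScalars ℂ).FG := Module.Finite.iff_fg.mp hW
    have h₂ : (W'.restrictScalars ℂ).FG := Module.Finite.iff_fg.mp hW'
    have := h₁.sup h₂
    rw [← Submodule.restrictScalars_sup] at this
    exact Module.Finite.iff_fg.mpr this
  smul_mem' u x hx := by
    change ∃ W : Submodule (U borel) X, FiniteDimensional ℂ W ∧ u • x ∈ W
    have hx : ∃ W : Submodule (U borel) X, FiniteDimensional ℂ W ∧ x ∈ W := hx
    induction u using uea_induction generalizing x with
    | halg c =>
      obtain ⟨W, hW, hx⟩ := hx
      refine ⟨W, hW, ?_⟩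
      rw [algebraMap_smul]
      exact (W.restrictScalars ℂ).smul_mem c hx
    | hι g =>
      obtain ⟨W, hW, hx⟩ := hx
      exact ⟨gSpan W, finiteDimensional_gSpan W, Submodule.apply_mem_map₂ (gAction X) trivial hx⟩
    | hmul u v hu hv => rw [mul_smul]; exact hu _ (hv _ hx hx) (hv _ hx hx)
    | hadd u v hu hv =>
      obtain ⟨W, hW, hx₁⟩ := hu _ hx hx
      obtain ⟨W', hW', hx₂⟩ := hv _ hx hx
      rw [add_smul]
      refine ⟨W ⊔ W', ?_, add_mem (Submodule.mem_sup_left hx₁) (Submodule.mem_sup_right hx₂)⟩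
      have h₁ : (W.restrictScalars ℂ).FG := Module.Finite.iff_fg.mp hW
      have h₂ : (W'.restrictScalars ℂ).FG := Module.Finite.iff_fg.mp hW'
      have := h₁.sup h₂
      rw [← Submodule.restrictScalars_sup] at this
      exact Module.Finite.iff_fg.mpr this

variable {X}

lemma map_mem_gamma {Y : Type*} [AddCommGroup Y] [Module (U borel) Y] [Module ℂ Y]
    [IsScalarTower ℂ (U borel) Y] (φ : Y →ₗ[U borel] X) (W : Submodule (U borel) Y)
    [FiniteDimensional ℂ W] {y : Y} (hy : y ∈ W) : φ y ∈ gamma X := by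
  refine ⟨W.map φ, ?_, Submodule.mem_map_of_mem hy⟩
  exact Module.Finite.of_surjective
    ({ toFun := fun y => ⟨φ y, Submodule.mem_map_of_mem y.2⟩
       map_add' := fun _ _ => Subtype.ext (map_add φ _ _)
       map_smul' := fun c y => Subtype.ext (map_complex_smul φ c y.1) } : W →ₗ[ℂ] W.map φ) (by
      rintro ⟨_, y, hy, rfl⟩
      exact ⟨⟨y, hy⟩, rfl⟩)

lemma isLocallyFinite_gamma : IsLocallyFinite (U borel) (gamma X) := by
  refine isLocallyFinite_of_forall_mem ?_
  rintro ⟨x, W, hW, hx⟩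
  refine ⟨W.comap (resMap (gamma X).subtype), ?_, hx⟩
  exact FiniteDimensional.of_injective
    ({ toFun := fun z => ⟨z.1.1, z.2⟩, map_add' := fun _ _ => rfl, map_smul' := fun _ _ => rfl } :
      W.comap (resMap (gamma X).subtype) →ₗ[ℂ] W) fun _ _ hab =>
    Subtype.ext (Subtype.ext (congrArg (fun z : W => (z : X)) hab))

/-- Restrictions of injective `𝔤`-modules to `b̄` are injective. -/
lemma baer_res (hX : Module.Baer (U G) X) : Module.Baer (U borel) X := by
  intro J g
  -- Frobenius reciprocity turns the extension problem over b̄ into one over 𝔤, along a map that is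
  -- injective because induction is exact.
  obtain ⟨k, hk⟩ := hX.extension_property (indMap J.subtype)
    (indMap_injective _ (Submodule.subtype_injective J)) (indLift g)
  refine ⟨(resMap k).comp (indMk (U borel)), fun x hx => ?_⟩
  have := LinearMap.congr_fun hk (indMk J ⟨x, hx⟩)
  simpa using this

/-- The locally finite part of a module that is injective over `b̄` is injective over `b̄`. -/
lemma baer_gamma (hX : Module.Baer (U borel) X) : Module.Baer (U borel) (gamma X) := by
  intro J g
  let j : gamma X →ₗ[U borel] X := resMap (gamma X).subtype
  -- An extension into X exists but may leave the locally finite part. It is replaced below by one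
  -- that factors through a finite dimensional quotient.
  obtain ⟨g', hg'⟩ := hX J (j.comp g)
  let K := LinearMap.ker g'
  let Y : Submodule (U borel) (U borel ⧸ K) := Submodule.map K.mkQ J
  let q : (U borel ⧸ K) →ₗ[U borel] X := K.liftQ g' le_rfl
  have hq : Function.Injective q := LinearMap.ker_eq_bot.mp (Submodule.ker_liftQ_eq_bot' _ _ rfl)
  have hqY : ∀ y ∈ Y, q y ∈ (LinearMap.range (j.comp g)) := by
    rintro _ ⟨x, hx, rfl⟩
    exact ⟨⟨x, hx⟩, (hg' x hx).symm⟩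
  -- U(b̄) is noetherian, so the image of J is finitely generated as well as locally finite.
  have hgfd : FiniteDimensional ℂ (LinearMap.range g) := by
    have : IsLocallyFinite (U borel) (LinearMap.range g) :=
      isLocallyFinite_gamma.of_injective (LinearMap.range g).subtype
        (Submodule.subtype_injective _)
    exact this.finiteDimensional
  have hfd : FiniteDimensional ℂ (LinearMap.range (j.comp g)) :=
    Module.Finite.of_surjective
      ({ toFun := fun y => ⟨j y.1, by obtain ⟨z, hz⟩ := y.2; exact ⟨z, by rw [← hz]; rfl⟩⟩
         map_add' := fun _ _ => rfl
         map_smul' := fun _ _ => rfl } : LinearMap.range g →ₗ[ℂ] LinearMap.range (j.comp g)) (by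
        rintro ⟨_, y, rfl⟩
        exact ⟨⟨g y, y, rfl⟩, rfl⟩)
  have : FiniteDimensional ℂ Y :=
    FiniteDimensional.of_injective
      ({ toFun := fun y => ⟨q y.1, hqY y.1 y.2⟩
         map_add' := fun _ _ => Subtype.ext (map_add q _ _)
         map_smul' := fun c y => Subtype.ext (map_complex_smul q c y.1) } :
        Y →ₗ[ℂ] LinearMap.range (j.comp g)) fun _ _ hab =>
      Subtype.ext (hq (congrArg (fun z : LinearMap.range (j.comp g) => (z : X)) hab))
  -- Artin-Rees embeds Y in a finite dimensional quotient. Extending from there by injectivity of X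
  -- sends 1 into a finite dimensional submodule, that is, into `gamma X`.
  obtain ⟨N, hN, hNfd⟩ := exists_finiteDimensional_quotient Y
  obtain ⟨θ, hθ⟩ := hX.extension_property (N.mkQ.comp Y.subtype) (by
    rw [← LinearMap.ker_eq_bot, eq_bot_iff]
    rintro ⟨y, hy⟩ h
    have : y ∈ N ⊓ Y := ⟨(Submodule.Quotient.mk_eq_zero N).mp h, hy⟩
    rw [hN] at this
    exact Subtype.ext this) (q.comp Y.subtype)
  let ψ : U borel →ₗ[U borel] X := θ.comp (N.mkQ.comp K.mkQ)
  have hψ : ψ 1 ∈ gamma X := by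
    have : FiniteDimensional ℂ (⊤ : Submodule (U borel) ((U borel ⧸ K) ⧸ N)) :=
      inferInstanceAs (FiniteDimensional ℂ (⊤ : Submodule ℂ ((U borel ⧸ K) ⧸ N)))
    exact map_mem_gamma θ ⊤ trivial
  refine ⟨LinearMap.toSpanSingleton (U borel) (gamma X) ⟨ψ 1, hψ⟩, fun x hx => Subtype.ext ?_⟩
  have h₁ : ψ x = q (K.mkQ x) := LinearMap.congr_fun hθ ⟨K.mkQ x, Submodule.mem_map_of_mem hx⟩
  have h₂ : q (K.mkQ x) = g' x := rfl
  change x • ψ 1 = (g ⟨x, hx⟩ : X)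
  rw [← map_smul, smul_eq_mul, mul_one, h₁, h₂, hg' x hx]
  rfl

/-- The locally finite part is a 𝔤-submodule containing 1 ⊗ V, which generates. -/
lemma isLocallyFinite_ind {V : Type*} [AddCommGroup V] [Module (U borel) V] [Module ℂ V]
    [IsScalarTower ℂ (U borel) V] [FiniteDimensional ℂ V] : IsLocallyFinite (U borel) (Ind V) := by
  refine isLocallyFinite_of_forall_mem fun w => ?_
  change w ∈ gamma (Ind V)
  induction w using ind_induction with
  | hmk u v =>
    have : FiniteDimensional ℂ (⊤ : Submodule (U borel) V) :=
      inferInstanceAs (FiniteDimensional ℂ (⊤ : Submodule ℂ V))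
    exact Submodule.smul_mem _ _ (map_mem_gamma (indMk V) ⊤ (Submodule.mem_top (x := v)))
  | hadd w w' hw hw' => exact add_mem hw hw'

lemma finite_ind {V : Type*} [AddCommGroup V] [Module (U borel) V] [Module ℂ V]
    [IsScalarTower ℂ (U borel) V] [Module.Finite (U borel) V] : Module.Finite (U G) (Ind V) := by
  classical
  obtain ⟨s, hs⟩ := Module.Finite.fg_top (R := U borel) (M := V)
  refine ⟨⟨s.image (indMk V), Submodule.eq_top_iff'.mpr fun w => ?_⟩⟩
  induction w using ind_induction with
  | hmk u v =>
    refine Submodule.smul_mem _ _ ?_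
    have hv : v ∈ Submodule.span (U borel) (s : Set V) := hs ▸ Submodule.mem_top
    induction hv using Submodule.span_induction with
    | mem v hv => exact Submodule.subset_span (by simpa using ⟨v, hv, rfl⟩)
    | zero => simp
    | add v w _ _ hv hw => rw [map_add]; exact add_mem hv hw
    | smul b v _ hv => rw [map_smul, res_smul]; exact Submodule.smul_mem _ _ hv
  | hadd w w' hw hw' => exact add_mem hw hw'

end LocallyFinite

end Takiff

namespace Takiff

open CategoryTheory CategoryTheory.Abelian
open scoped TensorProduct

attribute [local instance] LieRing.ofAssociativeRing
attribute [local instance 50] resModule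

/-! ### Shapiro-type vanishing of Ext from induced modules. -/

section Homological

open scoped ModuleCat

/-- Modules induced from free modules are projective. -/
lemma projective_ind_free (S : Type v) :
    Projective (ModuleCat.of (U G) (Ind (S →₀ U borel))) where
  factors {E X} f g hg := by
    have hsurj : Function.Surjective (resMap g.hom) := (ModuleCat.epi_iff_surjective g).mp hg
    obtain ⟨k, hk⟩ := Module.projective_lifting_property (resMap g.hom)
      ((resMap f.hom).comp (indMk (S →₀ U borel))) hsurj
    refine ⟨ModuleCat.ofHom (indLift k), ModuleCat.hom_ext (ind_hom_ext fun v => ?_)⟩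
    have h₁ : indLift k (indMk _ v) = k v := indLift_mk k v
    have h₂ := LinearMap.congr_fun hk v
    change g.hom (indLift k (indMk _ v)) = f.hom (indMk _ v)
    rw [h₁]
    exact h₂

variable {K F V : Type v} [AddCommGroup K] [Module (U borel) K] [Module ℂ K]
  [IsScalarTower ℂ (U borel) K] [AddCommGroup F] [Module (U borel) F] [Module ℂ F]
  [IsScalarTower ℂ (U borel) F] [AddCommGroup V] [Module (U borel) V] [Module ℂ V]
  [IsScalarTower ℂ (U borel) V]

/-- The complex of modules induced from an exact sequence. -/
noncomputable def indComplex (i : K →ₗ[U borel] F) (p : F →ₗ[U borel] V)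
    (h : Function.Exact i p) : ShortComplex (ModuleCat.{v} (U G)) :=
  ModuleCat.shortComplexOfCompEqZero (indMap i) (indMap p) (indMap_exact i p h).linearMap_comp_eq_zero

lemma indComplex_shortExact (i : K →ₗ[U borel] F) (p : F →ₗ[U borel] V)
    (h : Function.Exact i p) (hi : Function.Injective i) (hp : Function.Surjective p) :
    (indComplex i p h).ShortExact :=
  ModuleCat.shortComplex_shortExact _ (indMap_exact i p h)
    (indMap_injective i hi) (indMap_surjective p hp)

/-- Frobenius reciprocity combined with injectivity of X over b̄ alone. -/
lemma exists_indMap_comp {X : Type*} [AddCommGroup X] [Module (U G) X] [Module ℂ X]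
    [IsScalarTower ℂ (U G) X] (hX : Module.Baer (U borel) X)
    (i : K →ₗ[U borel] F) (hi : Function.Injective i) (φ : Ind K →ₗ[U G] X) :
    ∃ ψ : Ind F →ₗ[U G] X, ψ.comp (indMap i) = φ := by
  obtain ⟨k, hk⟩ := hX.extension_property i hi ((resMap φ).comp (indMk K))
  refine ⟨indLift k, ind_hom_ext fun v => ?_⟩
  rw [LinearMap.comp_apply, indMap_mk, indLift_mk]
  exact LinearMap.congr_fun hk v

lemma ext_eq_zero_of_extends {R : Type*} [Ring R] [Small.{v} R] {S : ShortComplex (ModuleCat.{v} R)}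
    (hS : S.ShortExact) {X : ModuleCat.{v} R} (k : S.X₂ ⟶ X) (g : S.X₁ ⟶ X) (h : S.f ≫ k = g) :
    hS.extClass.comp (Ext.mk₀ g) (add_zero 1) = 0 := by
  rw [← h, ← Ext.mk₀_comp_mk₀]
  exact hS.extClass_comp_assoc _

/-- Higher extensions of an induced module by a module that is injective over `b̄` vanish. -/
theorem ext_ind_eq_zero {X : ModuleCat.{v} (U G)} (hX : Module.Baer (U borel) X) (n : ℕ)
    (a : Ext.{v} (ModuleCat.of (U G) (Ind V)) X (n + 1)) : a = 0 := by
  -- Dimension shift along the induced free cover of V; V varies because the kernel of the cover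
  -- takes its place. In degree one what remains is a map from the induced kernel, which extends to
  -- the induced free module and so has zero connecting class.
  induction n generalizing V with
  | zero =>
    let p : (V →₀ U borel) →ₗ[U borel] V := Finsupp.linearCombination (U borel) id
    let i : LinearMap.ker p →ₗ[U borel] (V →₀ U borel) := (LinearMap.ker p).subtype
    have hi : Function.Injective i := Submodule.subtype_injective _
    have hp : Function.Surjective p := Finsupp.linearCombination_surjective _ Function.surjective_id
    have h : Function.Exact i p := LinearMap.exact_subtype_ker_map p
    have hS := indComplex_shortExact (K := LinearMap.ker p) i p h hi hp
    have : Projective (indComplex (K := LinearMap.ker p) i p h).X₂ := projective_ind_free V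
    obtain ⟨b, rfl⟩ := Ext.contravariant_sequence_exact₃ hS X a
      (Ext.eq_zero_of_projective _) (add_comm 1 0)
    obtain ⟨g, rfl⟩ := (Ext.mk₀_bijective _ _).2 b
    obtain ⟨k, hk⟩ := exists_indMap_comp (K := LinearMap.ker p) hX i hi g.hom
    have := ext_eq_zero_of_extends hS (ModuleCat.ofHom k) g (ModuleCat.hom_ext hk)
    exact this
  | succ n ih =>
    let p : (V →₀ U borel) →ₗ[U borel] V := Finsupp.linearCombination (U borel) id
    let i : LinearMap.ker p →ₗ[U borel] (V →₀ U borel) := (LinearMap.ker p).subtype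
    have hi : Function.Injective i := Submodule.subtype_injective _
    have hp : Function.Surjective p := Finsupp.linearCombination_surjective _ Function.surjective_id
    have h : Function.Exact i p := LinearMap.exact_subtype_ker_map p
    have hS := indComplex_shortExact (K := LinearMap.ker p) i p h hi hp
    have : Projective (indComplex (K := LinearMap.ker p) i p h).X₂ := projective_ind_free V
    obtain ⟨b, rfl⟩ := Ext.contravariant_sequence_exact₃ hS X a
      (Ext.eq_zero_of_projective _) (add_comm 1 (n + 1))
    have hb : b = 0 := ih b
    rw [hb, Ext.comp_zero]
    rfl

end Homological

end Takiff

namespace Takiff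

open CategoryTheory CategoryTheory.Abelian
open scoped TensorProduct

attribute [local instance] LieRing.ofAssociativeRing
attribute [local instance 50] resModule

/-! ### Effacing classes on modules induced from finite dimensional ones. -/

section Effaceable

open scoped ModuleCat

/-- A locally finite module embeds into one that is moreover injective over `b̄`. -/
lemma exists_shortExact_baer (N : ModuleCat.{v} (U G)) (hN : IsLocallyFinite (U borel) N) :
    ∃ (Y Q : ModuleCat.{v} (U G)) (i : N ⟶ Y) (q : Y ⟶ Q) (w : i ≫ q = 0),
      (ShortComplex.mk i q w).ShortExact ∧ Module.Baer (U borel) Y ∧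
      IsLocallyFinite (U borel) Y ∧ IsLocallyFinite (U borel) Q := by
  obtain ⟨⟨I, hI, j, hj⟩⟩ := EnoughInjectives.presentation N
  have hI' : Module.Injective (U G) I := Module.injective_module_of_injective_object (U G) I
  have hb : Module.Baer (U borel) (gamma I) := baer_gamma (baer_res (Module.Baer.of_injective hI'))
  have hmem : ∀ x, j.hom x ∈ gamma I := fun x =>
    have : FiniteDimensional ℂ (Submodule.span (U borel) {x}) := hN x
    map_mem_gamma (resMap j.hom) (Submodule.span (U borel) {x})
      (Submodule.mem_span_singleton_self x)
  let i : N ⟶ ModuleCat.of (U G) (gamma I) := ModuleCat.ofHom (j.hom.codRestrict (gamma I) hmem)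
  have hi : Mono i := (ModuleCat.mono_iff_injective i).mpr fun x y hxy =>
    (ModuleCat.mono_iff_injective j).mp hj (congrArg Subtype.val hxy)
  refine ⟨_, _, i, Limits.cokernel.π i, Limits.cokernel.condition i,
    { exact := ShortComplex.exact_cokernel i }, hb, isLocallyFinite_gamma, ?_⟩
  have hπ := (ModuleCat.epi_iff_surjective (Limits.cokernel.π i)).mp inferInstance
  exact IsLocallyFinite.of_surjective (resMap (Limits.cokernel.π i).hom) hπ isLocallyFinite_gamma

lemma exists_finiteDimensional_map_eq_top {A W V : Type*} [Ring A] [Algebra ℂ A] [AddCommGroup W]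
    [Module A W] [Module ℂ W] [IsScalarTower ℂ A W] [AddCommGroup V] [Module A V]
    [Module.Finite A V] (hW : IsLocallyFinite A W) (p : W →ₗ[A] V) (hp : Function.Surjective p) :
    ∃ W' : Submodule A W, FiniteDimensional ℂ W' ∧ ∀ v, ∃ w ∈ W', p w = v := by
  classical
  obtain ⟨s, hs⟩ := Module.Finite.fg_top (R := A) (M := V)
  choose l hl using hp
  let W' := Submodule.span A ((s.image l : Finset W) : Set W)
  have hW' : IsLocallyFinite A W' := hW.of_injective W'.subtype (Submodule.subtype_injective _)
  have : Module.Finite A W' := Module.Finite.iff_fg.mpr ⟨_, rfl⟩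
  refine ⟨W', hW'.finiteDimensional, fun v => ?_⟩
  have hv : v ∈ Submodule.span A (s : Set V) := hs ▸ Submodule.mem_top
  suffices Submodule.span A (s : Set V) ≤ W'.map p from this hv
  rw [Submodule.span_le]
  exact fun x hx => ⟨l x, Submodule.subset_span (by simpa using ⟨x, hx, rfl⟩), hl x⟩

variable {V : Type v} [AddCommGroup V] [Module (U borel) V] [Module ℂ V]
  [IsScalarTower ℂ (U borel) V]

lemma comp_indLift_eq {W Y Q : Type*} [AddCommGroup W] [Module (U borel) W] [Module ℂ W]
    [IsScalarTower ℂ (U borel) W] [AddCommGroup Y] [Module (U G) Y] [Module ℂ Y]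
    [IsScalarTower ℂ (U G) Y] [AddCommGroup Q] [Module (U G) Q]
    (q : Y →ₗ[U G] Q) (f : Ind V →ₗ[U G] Q) (φ : W →ₗ[U borel] V) (ψ : W →ₗ[U borel] Y)
    (h : ∀ w, q (ψ w) = f (indMk V (φ w))) : q.comp (indLift ψ) = f.comp (indMap φ) :=
  ind_hom_ext fun w => by
    rw [LinearMap.comp_apply, LinearMap.comp_apply, indMap_mk, indLift_mk, h]

/-- A homomorphism from an induced module to a quotient of a locally finite module lifts after
passing to a module induced from a larger finite dimensional module. -/
lemma exists_lift_of_surjective [FiniteDimensional ℂ V] {Y Q : Type v} [AddCommGroup Y]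
    [Module (U G) Y] [Module ℂ Y] [IsScalarTower ℂ (U G) Y] [AddCommGroup Q] [Module (U G) Q]
    [Module ℂ Q] [IsScalarTower ℂ (U G) Q]
    (hY : IsLocallyFinite (U borel) Y) (q : Y →ₗ[U G] Q) (hq : Function.Surjective q)
    (f : Ind V →ₗ[U G] Q) :
    ∃ (W : Type v) (_ : AddCommGroup W) (_ : Module (U borel) W) (_ : Module ℂ W)
      (_ : IsScalarTower ℂ (U borel) W) (_ : FiniteDimensional ℂ W) (φ : W →ₗ[U borel] V)
      (ψ : Ind W →ₗ[U G] Y), Function.Surjective φ ∧ q.comp ψ = f.comp (indMap φ) := by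
  -- The fibre product of V and Y over Q, taken over b̄: it is locally finite and maps onto V, so a
  -- finite dimensional part W already does.
  let E : Submodule (U borel) (V × Y) :=
    LinearMap.eqLocus (((resMap f).comp (indMk V)).comp (LinearMap.fst (U borel) V Y))
      ((resMap q).comp (LinearMap.snd (U borel) V Y))
  have hE : IsLocallyFinite (U borel) E :=
    .of_jointly_injective ((LinearMap.fst (U borel) V Y).comp E.subtype)
      ((LinearMap.snd (U borel) V Y).comp E.subtype)
      (fun _ h₁ h₂ => Subtype.ext (Prod.ext h₁ h₂)) isLocallyFinite_of_finiteDimensional hY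
  have : Module.Finite (U borel) V := Module.Finite.of_restrictScalars_finite ℂ (U borel) V
  obtain ⟨W, hW, hWV⟩ := exists_finiteDimensional_map_eq_top hE
    ((LinearMap.fst (U borel) V Y).comp E.subtype) (fun v => by
      obtain ⟨y, hy⟩ := hq (f (indMk V v))
      exact ⟨⟨(v, y), hy.symm⟩, rfl⟩)
  let φ : W →ₗ[U borel] V := ((LinearMap.fst (U borel) V Y).comp E.subtype).comp W.subtype
  let ψ : W →ₗ[U borel] Y := ((LinearMap.snd (U borel) V Y).comp E.subtype).comp W.subtype
  have hφ : Function.Surjective φ := fun v => by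
    obtain ⟨w, hw, h⟩ := hWV v
    exact ⟨⟨w, hw⟩, h⟩
  have h := comp_indLift_eq (W := W) q f φ ψ fun w => w.1.2.symm
  exact ⟨W, inferInstance, inferInstance, inferInstance, inferInstance, hW, φ, indLift (V := W) ψ, hφ, h⟩

lemma mk₀_comp_extClass_eq_zero {R : Type*} [Ring R] [Small.{v} R]
    {S : ShortComplex (ModuleCat.{v} R)} (hS : S.ShortExact) {X Z : ModuleCat.{v} R} (p : Z ⟶ X)
    (f : X ⟶ S.X₃) (ψ : Z ⟶ S.X₂) (h : ψ ≫ S.g = p ≫ f) :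
    (Ext.mk₀ p).comp ((Ext.mk₀ f).comp hS.extClass (zero_add 1)) (zero_add 1) = 0 := by
  rw [Ext.mk₀_comp_mk₀_assoc, ← h, ← Ext.mk₀_comp_mk₀_assoc, hS.comp_extClass, Ext.comp_zero]

lemma mk₀_comp_comp_eq_zero {C : Type*} [Category* C] [Abelian C] [HasExt.{v} C] {X Y Z T : C}
    (p : Z ⟶ X) {a b c : ℕ} {η : Ext X Y a} (h : (Ext.mk₀ p).comp η (zero_add a) = 0)
    (θ : Ext Y T b) (hc : a + b = c) : (Ext.mk₀ p).comp (η.comp θ hc) (zero_add c) = 0 := by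
  rw [← Ext.comp_assoc (h := by omega) (h₁₂ := zero_add a), h, Ext.zero_comp]

/-- Extension classes of positive degree from modules induced from finite dimensional modules to
locally finite modules are effaceable. -/
theorem exists_indMap_comp_eq_zero [FiniteDimensional ℂ V] {N : ModuleCat.{v} (U G)}
    (hN : IsLocallyFinite (U borel) N) (n : ℕ) (e : Ext.{v} (ModuleCat.of (U G) (Ind V)) N (n + 1)) :
    ∃ (W : Type v) (_ : AddCommGroup W) (_ : Module (U borel) W) (_ : Module ℂ W)
      (_ : IsScalarTower ℂ (U borel) W) (_ : FiniteDimensional ℂ W) (φ : W →ₗ[U borel] V),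
      Function.Surjective φ ∧
        (Ext.mk₀ (ModuleCat.ofHom (indMap φ))).comp e (zero_add _) = 0 := by
  -- Vanishing on Y writes e through a class of one degree less with values in Q. Since Q is locally
  -- finite but perhaps not finitely generated, N is only assumed locally finite.
  induction n generalizing N with
  | zero =>
    obtain ⟨Y, Q, i, q, w, hS, hb, hY, hQ⟩ := exists_shortExact_baer N hN
    obtain ⟨η, rfl⟩ := Ext.covariant_sequence_exact₁ _ hS e (ext_ind_eq_zero hb 0 _) rfl
    obtain ⟨f, rfl⟩ := (Ext.mk₀_bijective _ _).2 η
    have : Epi q := hS.epi_g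
    obtain ⟨W, _, _, _, _, hW, φ, ψ, hφ, h⟩ := exists_lift_of_surjective hY q.hom
      ((ModuleCat.epi_iff_surjective q).mp inferInstance) f.hom
    exact ⟨W, _, _, _, _, hW, φ, hφ, mk₀_comp_extClass_eq_zero hS (ModuleCat.ofHom (indMap φ)) f
      (ModuleCat.ofHom ψ) (ModuleCat.hom_ext h)⟩
  | succ n ih =>
    obtain ⟨Y, Q, i, q, w, hS, hb, hY, hQ⟩ := exists_shortExact_baer N hN
    obtain ⟨η, rfl⟩ := Ext.covariant_sequence_exact₁ _ hS e (ext_ind_eq_zero hb (n + 1) _) rfl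
    obtain ⟨W, _, _, _, _, hW, φ, hφ, h⟩ := ih hQ η
    exact ⟨W, _, _, _, _, hW, φ, hφ, mk₀_comp_comp_eq_zero _ h _ _⟩

end Effaceable

end Takiff

namespace Takiff

open CategoryTheory CategoryTheory.Abelian
open scoped TensorProduct

attribute [local instance] LieRing.ofAssociativeRing
attribute [local instance 50] resModule

/-! ### Epimorphisms in thick O that kill a given class. -/

section Main

open scoped ModuleCat

/-- Local finiteness does not depend on the choice of a compatible complex structure. -/
lemma isLocallyFinite_congr {A M : Type*} [Ring A] [Algebra ℂ A] [AddCommGroup M] [Module A M]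
    {m₁ : Module ℂ M} {h₁ : IsScalarTower ℂ A M} (h : IsLocallyFinite A M)
    {m₂ : Module ℂ M} {h₂ : IsScalarTower ℂ A M} : IsLocallyFinite A M := by
  have : m₁ = m₂ := by
    refine Module.ext' m₁ m₂ fun c m => ?_
    rw [← one_smul A m, ← @smul_assoc _ _ _ _ _ m₁.toSMul h₁, ← smul_assoc]
  subst this
  exact h

lemma thickO_of {X : Type v} [AddCommGroup X] [Module (U G) X] [Module ℂ X]
    [IsScalarTower ℂ (U G) X] (h₁ : Module.Finite (U G) X) (h₂ : IsLocallyFinite (U borel) X) :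
    thickO.{v} (ModuleCat.of (U G) X) :=
  ⟨h₁, isLocallyFinite_congr h₂⟩

lemma isLocallyFinite_of_thickO {M : ModuleCat.{v} (U G)} (h : thickO.{v} M) :
    IsLocallyFinite (U borel) M :=
  isLocallyFinite_congr h.2

/-- A finitely generated locally finite module is a quotient of a module induced from a finite
dimensional one. -/
lemma exists_indLift_surjective {X : Type v} [AddCommGroup X] [Module (U G) X] [Module ℂ X]
    [IsScalarTower ℂ (U G) X] [Module.Finite (U G) X] (hX : IsLocallyFinite (U borel) X) :
    ∃ (V : Type v) (_ : AddCommGroup V) (_ : Module (U borel) V) (_ : Module ℂ V)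
      (_ : IsScalarTower ℂ (U borel) V) (_ : FiniteDimensional ℂ V) (φ : Ind V →ₗ[U G] X),
      Function.Surjective φ := by
  obtain ⟨s, hs⟩ := Module.Finite.fg_top (R := U G) (M := X)
  -- Finitely generated over b̄ and locally finite, hence finite dimensional, and it generates X
  -- over 𝔤.
  let V := Submodule.span (U borel) (s : Set X)
  have hV : IsLocallyFinite (U borel) V := hX.of_injective V.subtype (Submodule.subtype_injective _)
  have : Module.Finite (U borel) V := Module.Finite.iff_fg.mpr ⟨s, rfl⟩
  have hfd := hV.finiteDimensional
  let j : V →ₗ[U borel] X := V.subtype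
  let φ : Ind V →ₗ[U G] X := indLift (V := V) j
  refine ⟨V, inferInstance, inferInstance, inferInstance, inferInstance, hfd, φ, ?_⟩
  rw [← LinearMap.range_eq_top, eq_top_iff, ← hs, Submodule.span_le]
  exact fun x hx => ⟨indMk V ⟨x, Submodule.subset_span hx⟩, indLift_mk (V := V) j _⟩

/-- Extension classes of positive degree between modules in thick category `O` are killed by
epimorphisms in thick category `O`. -/
lemma exists_thickO_epi_comp_eq_zero (M N : ThickO.{v}) (n : ℕ)
    (e : Ext.{v} (thickO.{v}.ι.obj M) (thickO.{v}.ι.obj N) (n + 1)) :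
    ∃ (P : ThickO.{v}) (p : P ⟶ M) (_ : Epi p),
      (Ext.mk₀ (thickO.{v}.ι.map p)).comp e (zero_add _) = 0 := by
  have : Module.Finite (U G) M.obj := M.property.1
  obtain ⟨V, _, _, _, _, hV, φ, hφ⟩ :=
    exists_indLift_surjective (isLocallyFinite_of_thickO M.property)
  let q : ModuleCat.of (U G) (Ind V) ⟶ thickO.{v}.ι.obj M := ModuleCat.ofHom φ
  -- Pulled back to Ind V, the class is killed by a further cover Ind W; the composite Ind W → Ind V
  -- → M is the epimorphism sought.
  obtain ⟨W, _, _, _, _, hW, ψ, hψ, h⟩ := exists_indMap_comp_eq_zero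
    (isLocallyFinite_of_thickO N.property) n ((Ext.mk₀ q).comp e (zero_add _))
  have : Module.Finite (U borel) W := Module.Finite.of_restrictScalars_finite ℂ (U borel) W
  let r : ModuleCat.of (U G) (Ind W) ⟶ ModuleCat.of (U G) (Ind V) := ModuleCat.ofHom (indMap ψ)
  let P : ThickO.{v} := ⟨ModuleCat.of (U G) (Ind W), thickO_of finite_ind isLocallyFinite_ind⟩
  let p : P ⟶ M := ObjectProperty.homMk (r ≫ q)
  have hr : Epi r := (ModuleCat.epi_iff_surjective r).mpr (indMap_surjective ψ hψ)
  have hq : Epi q := (ModuleCat.epi_iff_surjective q).mpr hφ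
  have hp : Epi (thickO.{v}.ι.map p) := epi_comp r q
  refine ⟨P, p, thickO.{v}.ι.epi_of_epi_map hp, ?_⟩
  change (Ext.mk₀ (r ≫ q)).comp e (zero_add _) = 0
  rw [← Ext.mk₀_comp_mk₀_assoc]
  exact h

end Main

end Takiff

theorem theorem6 (M N : Takiff.ThickO.{v}) (i : ℕ) :
    Function.Bijective
      (Takiff.thickO.{v}.ι.mapExtAddHom M N i :
        CategoryTheory.Abelian.Ext.{v + 1} M N i →+
          CategoryTheory.Abelian.Ext.{v} (Takiff.thickO.{v}.ι.obj M)
            (Takiff.thickO.{v}.ι.obj N) i) :=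
  Takiff.mapExt_bijective_of_effaceable _ Takiff.exists_thickO_epi_comp_eq_zero M N i
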